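/- Consider deterministic random access machines over a field $\mathbb F$, whose memory consists of arrays of natural numbers and arrays of elements of $\mathbb F$. An operation or zero test in $\mathbb F$ counts as one step, and an operation on natural numbers is charged one plus the bit length of its result (logarithmic cost); programs use no constants of $\mathbb F$ other than $0$ and $1$. An arithmetic circuit over $\mathbb F$ in the variables $x_1,\dots,x_n$ is a list of gates, each of which is a variable, a constant of $\mathbb F$, or the sum or the product of two earlier gates; its size is the number of gates, and one gate is designated as its output. It is given to the machine as the list of its gates. There is a single program with the following property. For every field $\mathbb F$, all integers $n\ge 1$ and $k\ge 0$, and every arithmetic circuit $C$ over $\mathbb F$ in $x_1,\dots,x_n$, given $C$ and $k$ it outputs the sum of the coefficients of all multilinear monomials of degree $k$ in the polynomial $f\in\mathbb F[x_1,\dots,x_n]$ computed by $C$ (the $(k,n)$-MLC problem). Moreover, for every polynomial $p$ with natural number coefficients there are a constant $c$ and a polynomial $q$, depending only on $p$ (not on $\mathbb F$, $n$, $k$ or $C$), such that whenever $C$ has size at most $p(n)$ the running time is at most $$q(n+k)\cdot n^{k/2+c\log_2 k},$$ that is, $O^*(n^{k/2+c\log k})$, where for $k=0$ the exponent is read as $0$.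 -/

import Mathlib

/-! ## Arithmetic circuits -/

/-- The `j`-th gate of an arithmetic circuit over `F` in the variables `x_0, …, x_{n-1}`: an input
gate (a variable or a field constant), or a sum or product of two earlier gates. -/
inductive ArithGate (F : Type*) (n j : ℕ) where
  | var (i : Fin n)
  | const (a : F)
  | add (l r : Fin j)
  | mul (l r : Fin j)

/-- An arithmetic circuit, its gates listed in a topological order. Its size is the number of
gates (input gates included); `out` is the output gate. -/
structure ArithCircuit (F : Type*) (n : ℕ) where
  size : ℕ
  gate : (j : Fin size) → ArithGate F n j
  out : Fin size

namespace ArithCircuit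

variable {F : Type*} {n : ℕ}

/-- The polynomial computed at gate `j`. -/
noncomputable def polyAt [CommSemiring F] (C : ArithCircuit F n) (j : Fin C.size) :
    MvPolynomial (Fin n) F :=
  match C.gate j with
  | .var i => MvPolynomial.X i
  | .const a => MvPolynomial.C a
  | .add l r => C.polyAt ⟨l, l.isLt.trans j.isLt⟩ + C.polyAt ⟨r, r.isLt.trans j.isLt⟩
  | .mul l r => C.polyAt ⟨l, l.isLt.trans j.isLt⟩ * C.polyAt ⟨r, r.isLt.trans j.isLt⟩
termination_by j.val
decreasing_by all_goals first | exact l.isLt | exact r.isLt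

/-- The polynomial computed by the circuit. -/
noncomputable def poly [CommSemiring F] (C : ArithCircuit F n) : MvPolynomial (Fin n) F :=
  C.polyAt C.out

end ArithCircuit

/-- The sum of the coefficients of all multilinear monomials of degree `k` in `f`. -/
noncomputable def multilinearCoeffSum {F : Type*} [CommSemiring F] {n : ℕ}
    (f : MvPolynomial (Fin n) F) (k : ℕ) : F :=
  ∑ m ∈ f.support with (m.degree = k ∧ ∀ i, m i ≤ 1), f.coeff m

/-! ## Random access machines over a field

A program manipulates finitely many arrays of natural numbers and finitely many arrays of field
elements; cells are addressed by computed natural numbers. Operations in the field cost one step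
each. Operations on natural numbers are charged by the bit lengths of the numbers involved
(logarithmic cost), so that they cannot be abused as a source of free parallelism. A program does
not mention the field: the only constants of the field it may use are `0` and `1`. -/

namespace FieldRAM

/-- A memory: `ints a i` is cell `i` of the array `a` of natural numbers, `flds a i` is cell `i`
of the array `a` of field elements. -/
structure State (F : Type*) where
  ints : ℕ → ℕ → ℕ
  flds : ℕ → ℕ → F

/-- Expressions with values in the natural numbers; subtraction is truncated, and division is
rounded down. -/
inductive IExp where
  | const (c : ℕ)
  | read (a : ℕ) (addr : IExp)
  | add (e₁ e₂ : IExp)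
  | sub (e₁ e₂ : IExp)
  | mul (e₁ e₂ : IExp)
  | div (e₁ e₂ : IExp)

/-- Expressions with values in the field. -/
inductive FExp where
  | zero
  | one
  | read (a : ℕ) (addr : IExp)
  | add (e₁ e₂ : FExp)
  | sub (e₁ e₂ : FExp)
  | mul (e₁ e₂ : FExp)
  | inv (e : FExp)

/-- Tests. -/
inductive BExp where
  | lt (e₁ e₂ : IExp)
  | eq (e₁ e₂ : IExp)
  | isZero (e : FExp)
  | not (b : BExp)
  | and (b₁ b₂ : BExp)

/-- Programs. `setI a i e` and `setF a i e` write the value of `e` into cell `i` of array `a`. -/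
inductive Cmd where
  | skip
  | setI (a : ℕ) (addr e : IExp)
  | setF (a : ℕ) (addr : IExp) (e : FExp)
  | seq (P Q : Cmd)
  | ite (b : BExp) (P Q : Cmd)
  | while (b : BExp) (P : Cmd)

variable {F : Type*}

def IExp.val (σ : State F) : IExp → ℕ
  | .const c => c
  | .read a i => σ.ints a (i.val σ)
  | .add e₁ e₂ => e₁.val σ + e₂.val σ
  | .sub e₁ e₂ => e₁.val σ - e₂.val σ
  | .mul e₁ e₂ => e₁.val σ * e₂.val σ
  | .div e₁ e₂ => e₁.val σ / e₂.val σ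

/-- Every operation on natural numbers costs one plus the bit length of its result, in addition to
the cost of its operands (so the bit lengths of operands and of addresses are charged too). -/
def IExp.cost (σ : State F) : IExp → ℕ
  | .const c => 1 + Nat.size c
  | .read a i => i.cost σ + 1 + Nat.size (σ.ints a (i.val σ))
  | .add e₁ e₂ => e₁.cost σ + e₂.cost σ + 1 + Nat.size (e₁.val σ + e₂.val σ)
  | .sub e₁ e₂ => e₁.cost σ + e₂.cost σ + 1 + Nat.size (e₁.val σ - e₂.val σ)
  | .mul e₁ e₂ => e₁.cost σ + e₂.cost σ + 1 + Nat.size (e₁.val σ * e₂.val σ)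
  | .div e₁ e₂ => e₁.cost σ + e₂.cost σ + 1 + Nat.size (e₁.val σ / e₂.val σ)

def FExp.val [Field F] (σ : State F) : FExp → F
  | .zero => 0
  | .one => 1
  | .read a i => σ.flds a (i.val σ)
  | .add e₁ e₂ => e₁.val σ + e₂.val σ
  | .sub e₁ e₂ => e₁.val σ - e₂.val σ
  | .mul e₁ e₂ => e₁.val σ * e₂.val σ
  | .inv e => (e.val σ)⁻¹

/-- Every operation in the field costs one. -/
def FExp.cost (σ : State F) : FExp → ℕ
  | .zero => 1
  | .one => 1
  | .read _ i => i.cost σ + 1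
  | .add e₁ e₂ => e₁.cost σ + e₂.cost σ + 1
  | .sub e₁ e₂ => e₁.cost σ + e₂.cost σ + 1
  | .mul e₁ e₂ => e₁.cost σ + e₂.cost σ + 1
  | .inv e => e.cost σ + 1

def BExp.holds [Field F] (σ : State F) : BExp → Prop
  | .lt e₁ e₂ => e₁.val σ < e₂.val σ
  | .eq e₁ e₂ => e₁.val σ = e₂.val σ
  | .isZero e => e.val σ = 0
  | .not b => ¬ b.holds σ
  | .and b₁ b₂ => b₁.holds σ ∧ b₂.holds σ

def BExp.cost (σ : State F) : BExp → ℕ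
  | .lt e₁ e₂ => e₁.cost σ + e₂.cost σ + 1
  | .eq e₁ e₂ => e₁.cost σ + e₂.cost σ + 1
  | .isZero e => e.cost σ + 1
  | .not b => b.cost σ + 1
  | .and b₁ b₂ => b₁.cost σ + b₂.cost σ + 1

def State.setI (σ : State F) (a i v : ℕ) : State F :=
  { σ with ints := Function.update σ.ints a (Function.update (σ.ints a) i v) }

def State.setF (σ : State F) (a i : ℕ) (v : F) : State F :=
  { σ with flds := Function.update σ.flds a (Function.update (σ.flds a) i v) }

/-- `Exec P σ σ' t`: started in the memory `σ`, the program `P` halts in the memory `σ'` after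
time `t`. -/
inductive Exec [Field F] : Cmd → State F → State F → ℕ → Prop where
  | skip (σ : State F) : Exec .skip σ σ 1
  | setI (σ : State F) (a : ℕ) (i e : IExp) :
      Exec (.setI a i e) σ (σ.setI a (i.val σ) (e.val σ)) (i.cost σ + e.cost σ + 1)
  | setF (σ : State F) (a : ℕ) (i : IExp) (e : FExp) :
      Exec (.setF a i e) σ (σ.setF a (i.val σ) (e.val σ)) (i.cost σ + e.cost σ + 1)
  | seq {P Q : Cmd} {σ₁ σ₂ σ₃ : State F} {t u : ℕ} :
      Exec P σ₁ σ₂ t → Exec Q σ₂ σ₃ u → Exec (.seq P Q) σ₁ σ₃ (t + u)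
  | ite_true {b : BExp} {P Q : Cmd} {σ₁ σ₂ : State F} {t : ℕ} :
      b.holds σ₁ → Exec P σ₁ σ₂ t → Exec (.ite b P Q) σ₁ σ₂ (b.cost σ₁ + t)
  | ite_false {b : BExp} {P Q : Cmd} {σ₁ σ₂ : State F} {t : ℕ} :
      ¬ b.holds σ₁ → Exec Q σ₁ σ₂ t → Exec (.ite b P Q) σ₁ σ₂ (b.cost σ₁ + t)
  | while_false {b : BExp} {P : Cmd} {σ : State F} :
      ¬ b.holds σ → Exec (.while b P) σ σ (b.cost σ)
  | while_true {b : BExp} {P : Cmd} {σ₁ σ₂ σ₃ : State F} {t u : ℕ} :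
      b.holds σ₁ → Exec P σ₁ σ₂ t → Exec (.while b P) σ₂ σ₃ u →
      Exec (.while b P) σ₁ σ₃ (b.cost σ₁ + t + u)

/-! ### Encoding of the input -/

section Encoding

variable {n j : ℕ}

/-- The code of the type of a gate. -/
def opcode : ArithGate F n j → ℕ
  | .var _ => 0
  | .const _ => 1
  | .add _ _ => 2
  | .mul _ _ => 3

/-- The index of the variable, or of the first operand. -/
def operand₁ : ArithGate F n j → ℕ
  | .var i => i
  | .const _ => 0
  | .add l _ => l
  | .mul l _ => l

/-- The index of the second operand. -/
def operand₂ : ArithGate F n j → ℕ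
  | .var _ => 0
  | .const _ => 0
  | .add _ r => r
  | .mul _ r => r

/-- The constant of a constant gate. -/
def constant [Zero F] : ArithGate F n j → F
  | .const a => a
  | _ => 0

/-- The initial memory on input `(C, k)`. Array `0` of natural numbers holds `n`, `k`, the size of
`C` and the index of its output gate; cell `j` of the arrays `1`, `2`, `3` holds the type and the
operands of gate `j`; cell `j` of the array `0` of field elements holds the constant of gate `j`.
All other cells are zero. -/
def input [Zero F] (C : ArithCircuit F n) (k : ℕ) : State F where
  ints := fun a i =>
    match a with
    | 0 => match i with
      | 0 => n
      | 1 => k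
      | 2 => C.size
      | 3 => C.out
      | _ => 0
    | 1 => if h : i < C.size then opcode (C.gate ⟨i, h⟩) else 0
    | 2 => if h : i < C.size then operand₁ (C.gate ⟨i, h⟩) else 0
    | 3 => if h : i < C.size then operand₂ (C.gate ⟨i, h⟩) else 0
    | _ => 0
  flds := fun a i =>
    match a with
    | 0 => if h : i < C.size then constant (C.gate ⟨i, h⟩) else 0
    | _ => 0

/-- The output is the field element in cell `0` of the array `1`. -/
def output (σ : State F) : F := σ.flds 1 0

end Encoding

end FieldRAM

/-! Inclusion-exclusion over repeated variables. Let d be the number of variables of exponent at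
least 2 in a monomial of degree k. Then 2d ≤ k, and the alternating sum of the binomials C(d, j) is
1 if d = 0 and 0 otherwise. Hence the wanted sum is Σ_{j ≤ k/2} (-1)^j L_j, where L_j adds up, over
all j-sets S of variables, the coefficients of the degree-k monomials divisible by x_i² for every i
in S (`multilinearCoeffSum_eq`). The identity is integral, so it holds in every characteristic.

For fixed S only the exponents on S capped at 2 and the degree capped at k + 1 matter. For a product
of monomials these data depend only on the data of the factors (`monomialCode_add`), so grouping
coefficients by them maps the polynomials to a finite-dimensional algebra in which the circuit is
evaluated gate by gate (`codeSum_mul`). The data are packed into a number below M = (k + 2)·5^j. A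
product gate is a convolution over M² pairs, which costs 25^j·poly(k) operations.

There are C(n, j) sets S, and C(n, j)·25^j ≤ n^j·25^j/j! ≤ K·n^j for the constant K = ⌈e^25⌉
(`choose_mul_pow_le`): the factorial absorbs the exponential cost, and c = 0 suffices. The sets are
enumerated as the numbers below n^j with increasing base-n digits; the other numbers cost only their
decoding.

Running times come from a Hoare-style logic (`Runs`) with a fixed bound b on all bit lengths. Here b
is polynomial in n, k and the size, so logarithmic cost only adds a polynomial factor. -/

namespace FieldRAM

variable {F : Type*}

/-! ## Static cost bounds -/

/-- If all cells are below `2 ^ b`, then the value of `e` is below `2 ^ (e.len * (b + 1))`. -/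
def IExp.len : IExp → ℕ
  | .const c => 1 + c
  | .read _ _ => 1
  | .add e₁ e₂ => e₁.len + e₂.len
  | .sub e₁ _ => e₁.len
  | .mul e₁ e₂ => e₁.len + e₂.len
  | .div e₁ _ => e₁.len

/-- If all cells are below `2 ^ b`, then `e` costs at most `e.weight * (b + 1)`. -/
def IExp.weight : IExp → ℕ
  | .const c => 1 + c
  | .read _ i => i.weight + 1
  | .add e₁ e₂ => e₁.weight + e₂.weight + 1 + (e₁.len + e₂.len)
  | .sub e₁ e₂ => e₁.weight + e₂.weight + 1 + e₁.len
  | .mul e₁ e₂ => e₁.weight + e₂.weight + 1 + (e₁.len + e₂.len)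
  | .div e₁ e₂ => e₁.weight + e₂.weight + 1 + e₁.len

def FExp.weight : FExp → ℕ
  | .zero => 1
  | .one => 1
  | .read _ i => i.weight + 1
  | .add e₁ e₂ => e₁.weight + e₂.weight + 1
  | .sub e₁ e₂ => e₁.weight + e₂.weight + 1
  | .mul e₁ e₂ => e₁.weight + e₂.weight + 1
  | .inv e => e.weight + 1

def BExp.weight : BExp → ℕ
  | .lt e₁ e₂ => e₁.weight + e₂.weight + 1
  | .eq e₁ e₂ => e₁.weight + e₂.weight + 1
  | .isZero e => e.weight + 1
  | .not b => b.weight + 1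
  | .and b₁ b₂ => b₁.weight + b₂.weight + 1

/-- All natural numbers in the memory have at most `b` bits. -/
def Bounded (b : ℕ) (σ : State F) : Prop := ∀ a i, σ.ints a i < 2 ^ b

theorem IExp.len_pos (e : IExp) : 0 < e.len := by
  induction e <;> simp only [IExp.len] <;> omega

theorem IExp.val_lt {b : ℕ} {σ : State F} (h : Bounded b σ) (e : IExp) :
    e.val σ < 2 ^ (e.len * (b + 1)) := by
  -- Both bounds being at least 2, their product dominates their sum; this makes lengths additive
  -- for sums as well as for products.
  have two (e : IExp) : 2 ≤ 2 ^ (e.len * (b + 1)) :=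
    le_self_pow₀ one_le_two (Nat.mul_ne_zero e.len_pos.ne' (by omega))
  induction e with
  | const c =>
    refine (Nat.lt_two_pow_self (n := c)).trans_le (Nat.pow_le_pow_right two_pos ?_)
    simp only [IExp.len]
    nlinarith
  | read a i ih =>
    refine (h a _).trans_le (Nat.pow_le_pow_right two_pos ?_)
    simp [IExp.len]
  | add e₁ e₂ h₁ h₂ =>
    simp only [IExp.val, IExp.len, add_mul, pow_add _ (_ * _)]
    nlinarith [two e₁, two e₂]
  | sub e₁ e₂ h₁ h₂ => exact (Nat.sub_le _ _).trans_lt h₁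
  | mul e₁ e₂ h₁ h₂ =>
    simp only [IExp.val, IExp.len, add_mul, pow_add _ (_ * _)]
    exact Nat.mul_lt_mul'' h₁ h₂
  | div e₁ e₂ h₁ h₂ => exact (Nat.div_le_self _ _).trans_lt h₁

theorem IExp.cost_le {b : ℕ} {σ : State F} (h : Bounded b σ) (e : IExp) :
    e.cost σ ≤ e.weight * (b + 1) := by
  have key (e : IExp) : Nat.size (e.val σ) ≤ e.len * (b + 1) := Nat.size_le.2 (e.val_lt h)
  induction e with
  | const c =>
    have : Nat.size c ≤ c := Nat.size_le.2 Nat.lt_two_pow_self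
    simp only [IExp.cost, IExp.weight]
    nlinarith
  | read a i ih =>
    have : Nat.size (σ.ints a (i.val σ)) ≤ b := Nat.size_le.2 (h _ _)
    simp only [IExp.cost, IExp.weight]
    nlinarith
  | add e₁ e₂ h₁ h₂ =>
    have := key (.add e₁ e₂)
    simp only [IExp.cost, IExp.weight, IExp.val, IExp.len] at *
    nlinarith
  | sub e₁ e₂ h₁ h₂ =>
    have := key (.sub e₁ e₂)
    simp only [IExp.cost, IExp.weight, IExp.val, IExp.len] at *
    nlinarith
  | mul e₁ e₂ h₁ h₂ =>
    have := key (.mul e₁ e₂)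
    simp only [IExp.cost, IExp.weight, IExp.val, IExp.len] at *
    nlinarith
  | div e₁ e₂ h₁ h₂ =>
    have := key (.div e₁ e₂)
    simp only [IExp.cost, IExp.weight, IExp.val, IExp.len] at *
    nlinarith

theorem FExp.cost_le {b : ℕ} {σ : State F} (h : Bounded b σ) (e : FExp) :
    e.cost σ ≤ e.weight * (b + 1) := by
  induction e with
  | read a i =>
    have := i.cost_le h
    simp only [FExp.cost, FExp.weight]
    nlinarith
  | _ => simp only [FExp.cost, FExp.weight] at *; nlinarith

theorem BExp.cost_le {b : ℕ} {σ : State F} (h : Bounded b σ) (e : BExp) :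
    e.cost σ ≤ e.weight * (b + 1) := by
  induction e with
  | lt e₁ e₂ | eq e₁ e₂ =>
    have := e₁.cost_le h
    have := e₂.cost_le h
    simp only [BExp.cost, BExp.weight]
    nlinarith
  | isZero e =>
    have := e.cost_le h
    simp only [BExp.cost, BExp.weight]
    nlinarith
  | _ => simp only [BExp.cost, BExp.weight] at *; nlinarith

/-! ## Frames -/

/-- The arrays of natural numbers that a program may write to. -/
def Cmd.writesI : Cmd → List ℕ
  | .setI a _ _ => [a]
  | .seq P Q => P.writesI ++ Q.writesI
  | .ite _ P Q => P.writesI ++ Q.writesI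
  | .while _ P => P.writesI
  | _ => []

/-- The arrays of field elements that a program may write to. -/
def Cmd.writesF : Cmd → List ℕ
  | .setF a _ _ => [a]
  | .seq P Q => P.writesF ++ Q.writesF
  | .ite _ P Q => P.writesF ++ Q.writesF
  | .while _ P => P.writesF
  | _ => []

/-- `σ'` differs from `σ` at most in the arrays that `P` may write to. -/
structure Frame (P : Cmd) (σ σ' : State F) : Prop where
  ints : ∀ a, a ∉ P.writesI → σ'.ints a = σ.ints a
  flds : ∀ a, a ∉ P.writesF → σ'.flds a = σ.flds a

theorem Frame.refl (P : Cmd) (σ : State F) : Frame P σ σ := ⟨fun _ _ => rfl, fun _ _ => rfl⟩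

theorem Frame.trans {P : Cmd} {σ₁ σ₂ σ₃ : State F} (h : Frame P σ₁ σ₂) (h' : Frame P σ₂ σ₃) :
    Frame P σ₁ σ₃ :=
  ⟨fun a ha => (h'.ints a ha).trans (h.ints a ha), fun a ha => (h'.flds a ha).trans (h.flds a ha)⟩

theorem Frame.mono {P Q : Cmd} {σ σ' : State F} (h : Frame P σ σ')
    (hI : P.writesI ⊆ Q.writesI) (hF : P.writesF ⊆ Q.writesF) : Frame Q σ σ' :=
  ⟨fun a ha => h.ints a fun h => ha (hI h), fun a ha => h.flds a fun h => ha (hF h)⟩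

@[simp] theorem State.setI_ints (σ : State F) (a i v a' : ℕ) :
    (σ.setI a i v).ints a' = if a' = a then Function.update (σ.ints a) i v else σ.ints a' := by
  by_cases h : a' = a
  · subst h; simp [State.setI]
  · simp [State.setI, h]

@[simp] theorem State.setI_flds (σ : State F) (a i v : ℕ) : (σ.setI a i v).flds = σ.flds := rfl

@[simp] theorem State.setF_ints (σ : State F) (a i : ℕ) (v : F) :
    (σ.setF a i v).ints = σ.ints := rfl

@[simp] theorem State.setF_flds (σ : State F) (a i : ℕ) (v : F) (a' : ℕ) :
    (σ.setF a i v).flds a' = if a' = a then Function.update (σ.flds a) i v else σ.flds a' := by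
  by_cases h : a' = a
  · subst h; simp [State.setF]
  · simp [State.setF, h]

theorem Bounded.setI {b : ℕ} {σ : State F} (h : Bounded b σ) {a i v : ℕ} (hv : v < 2 ^ b) :
    Bounded b (σ.setI a i v) := by
  intro a' i'
  rw [State.setI_ints]
  split_ifs
  · rw [Function.update_apply]
    split_ifs
    exacts [hv, h _ _]
  · exact h _ _

variable [Field F]

/-- The footprint is syntactic, so the preservation of any untouched array reduces to a list
membership settled by `decide`. -/
theorem Exec.frame {P : Cmd} {σ σ' : State F} {t : ℕ} (h : Exec P σ σ' t) : Frame P σ σ' := by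
  induction h with
  | skip σ => exact Frame.refl _ _
  | setI σ a i e =>
    refine ⟨fun a' ha => ?_, fun _ _ => rfl⟩
    rw [State.setI_ints, if_neg (by simpa [Cmd.writesI] using ha)]
  | setF σ a i e =>
    refine ⟨fun _ _ => rfl, fun a' ha => ?_⟩
    rw [State.setF_flds, if_neg (by simpa [Cmd.writesF] using ha)]
  | seq _ _ h₁ h₂ =>
    exact (h₁.mono (List.subset_append_left _ _) (List.subset_append_left _ _)).trans
      (h₂.mono (List.subset_append_right _ _) (List.subset_append_right _ _))
  | ite_true _ _ h => exact h.mono (List.subset_append_left _ _) (List.subset_append_left _ _)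
  | ite_false _ _ h => exact h.mono (List.subset_append_right _ _) (List.subset_append_right _ _)
  | while_false _ => exact Frame.refl _ _
  | while_true _ _ _ h₁ h₂ => exact Frame.trans (P := .while _ _) ⟨h₁.ints, h₁.flds⟩ h₂

/-! ## A program logic for running times -/

/-- Started in `σ`, and provided that all natural numbers have at most `b` bits, `P` halts in a
memory that satisfies `Q` within `T` units of time, and keeps all numbers below `2 ^ b`. A unit is
enough for any command or test of weight at most `200`. -/
def Runs (b : ℕ) (P : Cmd) (σ : State F) (T : ℕ) (Q : State F → Prop) : Prop :=
  Bounded b σ →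
    ∃ σ' t, Exec P σ σ' t ∧ t ≤ T * (200 * (b + 1)) ∧ Bounded b σ' ∧ Q σ'

variable {b : ℕ} {P P' : Cmd} {σ : State F} {T T' : ℕ} {Q Q' : State F → Prop}

/-- The frame comes for free from determinate footprints, so specifications need only mention what
changes. -/
theorem Runs.mono (h : Runs b P σ T Q) (hT : T ≤ T') (hQ : ∀ σ', Frame P σ σ' → Q σ' → Q' σ') :
    Runs b P σ T' Q' := fun hb => by
  obtain ⟨σ', t, h₁, h₂, h₃, h₄⟩ := h hb
  exact ⟨σ', t, h₁, h₂.trans (Nat.mul_le_mul_right _ hT), h₃, hQ _ h₁.frame h₄⟩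

theorem Runs.mono_time (h : Runs b P σ T Q) (hT : T ≤ T') : Runs b P σ T' Q :=
  h.mono hT fun _ _ h => h

/-- Lets size facts about values already stored in the memory be used in proving a specification. -/
theorem Runs.with_bounded (h : Bounded b σ → Runs b P σ T Q) : Runs b P σ T Q :=
  fun hb => h hb hb

theorem Runs.skip (hQ : Q σ) : Runs b .skip σ 1 Q :=
  fun hb => ⟨σ, 1, .skip σ, by omega, hb, hQ⟩

theorem Runs.setI {a : ℕ} {i e : IExp} (hv : Bounded b σ → e.val σ < 2 ^ b)
    (hQ : Q (σ.setI a (i.val σ) (e.val σ))) (hw : i.weight + e.weight + 1 ≤ 200 := by decide) :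
    Runs b (.setI a i e) σ 1 Q := fun hb => by
  refine ⟨_, _, .setI σ a i e, ?_, hb.setI (hv hb), hQ⟩
  have := i.cost_le hb
  have := e.cost_le hb
  nlinarith [Nat.mul_le_mul_right (b + 1) hw]

theorem Runs.setF {a : ℕ} {i : IExp} {e : FExp}
    (hQ : Q (σ.setF a (i.val σ) (e.val σ))) (hw : i.weight + e.weight + 1 ≤ 200 := by decide) :
    Runs b (.setF a i e) σ 1 Q := fun hb => by
  refine ⟨_, _, .setF σ a i e, ?_, hb, hQ⟩
  have := i.cost_le hb
  have := e.cost_le hb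
  nlinarith [Nat.mul_le_mul_right (b + 1) hw]

/-- The specification of the second command is itself the postcondition of the first, so proofs
follow the program text forwards. -/
theorem Runs.seq (h : Runs b P σ T fun σ' => Frame P σ σ' → Runs b P' σ' T' Q) :
    Runs b (.seq P P') σ (T + T') Q := fun hb => by
  obtain ⟨σ₁, t, h₁, h₂, h₃, h₄⟩ := h hb
  obtain ⟨σ₂, u, k₁, k₂, k₃, k₄⟩ := h₄ h₁.frame h₃
  exact ⟨σ₂, t + u, h₁.seq k₁, by rw [add_mul]; exact add_le_add h₂ k₂, k₃, k₄⟩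

theorem Runs.ite {e : BExp} (h₁ : e.holds σ → Runs b P σ T Q) (h₂ : ¬ e.holds σ → Runs b P' σ T Q)
    (hw : e.weight ≤ 200 := by decide) : Runs b (.ite e P P') σ (T + 1) Q := fun hb => by
  have hc : e.cost σ ≤ 200 * (b + 1) := (e.cost_le hb).trans (Nat.mul_le_mul_right _ hw)
  by_cases h : e.holds σ
  · obtain ⟨σ', t, k₁, k₂, k₃, k₄⟩ := h₁ h hb
    exact ⟨σ', _, .ite_true h k₁, by linarith, k₃, k₄⟩
  · obtain ⟨σ', t, k₁, k₂, k₃, k₄⟩ := h₂ h hb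
    exact ⟨σ', _, .ite_false h k₁, by linarith, k₃, k₄⟩

/-- The scalar variable held in cell `0` of the array `a`. -/
abbrev IExp.var (a : ℕ) : IExp := .read a (.const 0)

/-- Assignment to a scalar variable. -/
abbrev Cmd.assign (a : ℕ) (e : IExp) : Cmd := .setI a (.const 0) e

/-- Repeat `P` with the scalar variable `a` running through the numbers below `e`. -/
def Cmd.loop (a : ℕ) (e : IExp) (P : Cmd) : Cmd :=
  .seq (.assign a (.const 0))
    (.while (.lt (.var a) e) (.seq P (.assign a (.add (.var a) (.const 1)))))

/-- `Inv i` is asserted when the counter has just been set to `i`. The times `T i` may vary with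
`i`, which is what allows cheap and expensive tuples to be charged separately. The surcharge 2 per
round pays for the test and the increment. -/
theorem Runs.loop {a : ℕ} {e : IExp} {m : ℕ} {T : ℕ → ℕ} (Inv : ℕ → State F → Prop)
    (he : ∀ σ', Frame (.loop a e P) σ σ' → e.val σ' = m) (hm : Bounded b σ → m < 2 ^ b)
    (h0 : Inv 0 (σ.setI a 0 0))
    (hstep : ∀ i σ', i < m → Frame (.loop a e P) σ σ' → σ'.ints a 0 = i → Inv i σ' →
      Runs b P σ' (T i) fun σ'' => Frame P σ' σ'' → Inv (i + 1) (σ''.setI a 0 (i + 1)))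
    (hQ : ∀ σ', Frame (.loop a e P) σ σ' → Inv m σ' → Q σ')
    (ha : a ∉ P.writesI := by decide) (hw : e.weight ≤ 100 := by decide) :
    Runs b (.loop a e P) σ (∑ i ∈ Finset.range m, (T i + 2) + 2) Q := by
  intro hb
  have hcond {σ' : State F} (hb' : Bounded b σ') :
      (BExp.lt (.var a) e).cost σ' ≤ 200 * (b + 1) := by
    refine ((BExp.lt (.var a) e).cost_le hb').trans (Nat.mul_le_mul_right _ ?_)
    simp only [BExp.weight, IExp.weight]
    omega
  have hfr : Frame (.loop a e P) σ (σ.setI a 0 0) := by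
    refine ⟨fun a' ha' => ?_, fun _ _ => rfl⟩
    rw [State.setI_ints, if_neg]
    rintro rfl
    simp [Cmd.loop, Cmd.writesI] at ha'
  -- Induction on the number `d` of rounds left, since `while` unfolds at its front.
  have main (d : ℕ) : ∀ i σ', i + d = m → Bounded b σ' → Frame (.loop a e P) σ σ' →
      σ'.ints a 0 = i → Inv i σ' → ∃ σ'' t,
        Exec (.while (.lt (.var a) e) (.seq P (.assign a (.add (.var a) (.const 1))))) σ' σ'' t ∧
        t ≤ (∑ i ∈ Finset.Ico i m, (T i + 2) + 1) * (200 * (b + 1)) ∧ Bounded b σ'' ∧ Q σ'' := by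
    induction d with
    | zero =>
      rintro i σ' hi hb' hf hai hinv
      obtain rfl : i = m := by omega
      refine ⟨σ', _, .while_false ?_, ?_, hb', hQ _ hf hinv⟩
      · simp [BExp.holds, IExp.val, hai, he _ hf]
      · simpa using hcond hb'
    | succ d ih =>
      rintro i σ' hi hb' hf hai hinv
      have him : i < m := by omega
      obtain ⟨σ₁, t, h₁, h₂, h₃, h₄⟩ := hstep i σ' him hf hai hinv hb'
      have ha₁ : σ₁.ints a 0 = i := by rw [h₁.frame.ints a ha, hai]
      have hb₁ : Bounded b (σ₁.setI a 0 (i + 1)) := h₃.setI (by have := hm hb; omega)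
      have hf₁ : Frame (.loop a e P) σ (σ₁.setI a 0 (i + 1)) := by
        refine hf.trans ⟨fun a' ha' => ?_, fun a' ha' => ?_⟩
        · simp only [Cmd.loop, Cmd.writesI, List.mem_append, List.mem_singleton, not_or] at ha'
          rw [State.setI_ints, if_neg ha'.1, h₁.frame.ints a' ha'.2.1]
        · simp only [Cmd.loop, Cmd.writesF, List.nil_append, List.append_nil] at ha'
          rw [State.setI_flds, h₁.frame.flds a' ha']
      obtain ⟨σ₂, u, k₁, k₂, k₃, k₄⟩ :=
        ih (i + 1) (σ₁.setI a 0 (i + 1)) (by omega) hb₁ hf₁ (by simp) (h₄ h₁.frame)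
      have hx : Exec (.assign a (.add (.var a) (.const 1))) σ₁ (σ₁.setI a 0 (i + 1))
          ((IExp.const 0).cost σ₁ + (IExp.add (.var a) (.const 1)).cost σ₁ + 1) := by
        have := Exec.setI σ₁ a (.const 0) (.add (.var a) (.const 1))
        simpa only [IExp.val, ha₁] using this
      have hxc : (IExp.const 0).cost σ₁ + (IExp.add (.var a) (.const 1)).cost σ₁ + 1 ≤
          200 * (b + 1) := by
        have c₁ := (IExp.const 0).cost_le h₃
        have c₂ := (IExp.add (.var a) (.const 1)).cost_le h₃
        simp only [IExp.weight, IExp.len] at c₁ c₂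
        omega
      refine ⟨σ₂, _, .while_true ?_ (h₁.seq hx) k₁, ?_, k₃, k₄⟩
      · simp [BExp.holds, IExp.val, hai, he _ hf, him]
      · rw [Finset.sum_eq_sum_Ico_succ_bot him]
        have := hcond hb'
        linarith
  obtain ⟨σ', t, h₁, h₂, h₃, h₄⟩ := main m 0 (σ.setI a 0 0) (by omega) (hb.setI (by positivity)) hfr
    (by simp) h0
  refine ⟨σ', _, .seq (.setI σ a (.const 0) (.const 0)) h₁, ?_, h₃, h₄⟩
  rw [Finset.range_eq_Ico]
  simp only [IExp.cost, Nat.size_zero]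
  linarith

theorem Runs.loop_const {a : ℕ} {e : IExp} {m T : ℕ} (Inv : ℕ → State F → Prop)
    (he : ∀ σ', Frame (.loop a e P) σ σ' → e.val σ' = m) (hm : Bounded b σ → m < 2 ^ b)
    (h0 : Inv 0 (σ.setI a 0 0))
    (hstep : ∀ i σ', i < m → Frame (.loop a e P) σ σ' → σ'.ints a 0 = i → Inv i σ' →
      Runs b P σ' T fun σ'' => Frame P σ' σ'' → Inv (i + 1) (σ''.setI a 0 (i + 1)))
    (hQ : ∀ σ', Frame (.loop a e P) σ σ' → Inv m σ' → Q σ')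
    (ha : a ∉ P.writesI := by decide) (hw : e.weight ≤ 100 := by decide) :
    Runs b (.loop a e P) σ (m * (T + 2) + 2) Q := by
  simpa using Runs.loop (T := fun _ => T) Inv he hm h0 hstep hQ ha hw

theorem Runs.setI_seq {a : ℕ} {i e : IExp} (hv : Bounded b σ → e.val σ < 2 ^ b)
    (h : Runs b P (σ.setI a (i.val σ) (e.val σ)) T Q)
    (hw : i.weight + e.weight + 1 ≤ 200 := by decide) :
    Runs b (.seq (.setI a i e) P) σ (T + 1) Q := by
  rw [add_comm]
  exact Runs.seq (Runs.setI hv (fun _ => h) hw)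

theorem Runs.setF_seq {a : ℕ} {i : IExp} {e : FExp}
    (h : Runs b P (σ.setF a (i.val σ) (e.val σ)) T Q)
    (hw : i.weight + e.weight + 1 ≤ 200 := by decide) :
    Runs b (.seq (.setF a i e) P) σ (T + 1) Q := by
  rw [add_comm]
  exact Runs.seq (Runs.setF (fun _ => h) hw)

end FieldRAM

/-! ## Codes of truncated monomials -/

namespace FieldRAM

/-- The number with the `j` lowest digits `a 0, …, a (j - 1)` in base `5`, and the rest `D`. -/
def code (a : ℕ → ℕ) : ℕ → ℕ → ℕ
  | 0, D => D
  | j + 1, D => a 0 + 5 * code (fun l => a (l + 1)) j D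

/-- Truncate the `j` lowest digits in base `5` at `2`, and the rest at `K`. -/
def reduceCode (K : ℕ) : ℕ → ℕ → ℕ
  | 0, c => min c K
  | j + 1, c => min (c % 5) 2 + 5 * reduceCode K j (c / 5)

theorem reduceCode_le (K j c : ℕ) : reduceCode K j c ≤ c := by
  induction j generalizing c with
  | zero => exact min_le_left _ _
  | succ j ih =>
    have := ih (c / 5)
    simp only [reduceCode]
    omega

theorem code_add (a a' : ℕ → ℕ) (j D D' : ℕ) :
    code a j D + code a' j D' = code (fun l => a l + a' l) j (D + D') := by
  induction j generalizing a a' with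
  | zero => rfl
  | succ j ih =>
    simp only [code, ← ih]
    ring

/-- The remainder mod 5 recovers each digit because no carry occurs. Base 5 is chosen for this: two
exponents capped at 2 add up to at most 4. -/
theorem reduceCode_code {a : ℕ → ℕ} {j : ℕ} (ha : ∀ l < j, a l < 5) (K D : ℕ) :
    reduceCode K j (code a j D) = code (fun l => min (a l) 2) j (min D K) := by
  induction j generalizing a with
  | zero => rfl
  | succ j ih =>
    have h0 := ha 0 (by omega)
    simp only [code, reduceCode]
    rw [← ih fun l hl => ha (l + 1) (by omega)]
    congr 2
    · omega
    · congr 1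
      omega

theorem code_lt {a : ℕ → ℕ} {j : ℕ} (ha : ∀ l < j, a l < 5) (D : ℕ) :
    code a j D < (D + 1) * 5 ^ j := by
  induction j generalizing a with
  | zero => simp [code]
  | succ j ih =>
    have h0 := ha 0 (by omega)
    have := ih (a := fun l => a (l + 1)) fun l hl => ha (l + 1) (by omega)
    simp only [code, pow_succ]
    rw [← mul_assoc]
    omega

theorem code_inj {a a' : ℕ → ℕ} {j : ℕ} (ha : ∀ l < j, a l < 5) (ha' : ∀ l < j, a' l < 5)
    {D D' : ℕ} : code a j D = code a' j D' ↔ (∀ l < j, a l = a' l) ∧ D = D' := by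
  induction j generalizing a a' with
  | zero => simp [code]
  | succ j ih =>
    have h0 := ha 0 (by omega)
    have h0' := ha' 0 (by omega)
    have := ih (a := fun l => a (l + 1)) (a' := fun l => a' (l + 1))
      (fun l hl => ha (l + 1) (by omega)) (fun l hl => ha' (l + 1) (by omega))
    rw [Nat.forall_lt_succ_left, and_assoc, ← this]
    simp only [code]
    omega

/-- Geometric series: the sum of 2·5^l over l < j is (5^j - 1)/2. The program finds the cell of the
target code by this closed form. -/
theorem code_two (j D : ℕ) : code (fun _ => 2) j D = D * 5 ^ j + (5 ^ j - 1) / 2 := by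
  -- Doubling and adding one removes the division and the truncated subtraction; the way back uses
  -- that 5^j is odd.
  suffices h : 2 * code (fun _ => 2) j D + 1 = (2 * D + 1) * 5 ^ j by
    have h5 : (5 ^ j) % 2 = 1 := by simp [Nat.pow_mod]
    have : (2 * D + 1) * 5 ^ j = 2 * (D * 5 ^ j) + 5 ^ j := by ring
    rw [this] at h
    generalize D * 5 ^ j = x, 5 ^ j = y at *
    omega
  induction j with
  | zero => simp [code]
  | succ j ih =>
    simp only [code, pow_succ, ← mul_assoc, ← ih]
    ring

section MonomialCode

variable {n : ℕ}

/-- The code of a monomial: its exponents at `v 0, …, v (j - 1)` truncated at `2`, and its degree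
truncated at `k + 1`. -/
noncomputable def monomialCode (v : ℕ → Fin n) (j k : ℕ) (m : Fin n →₀ ℕ) : ℕ :=
  code (fun l => min (m (v l)) 2) j (min m.degree (k + 1))

variable (v : ℕ → Fin n) (j k : ℕ)

theorem monomialCode_lt (m : Fin n →₀ ℕ) : monomialCode v j k m < (k + 2) * 5 ^ j :=
  (code_lt (fun l _ => by omega) _).trans_le (Nat.mul_le_mul_right _ (by omega))

theorem monomialCode_zero : monomialCode v j k 0 = 0 := by
  simp only [monomialCode, Finsupp.coe_zero, Pi.zero_apply, map_zero, Nat.zero_min]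
  induction j with
  | zero => rfl
  | succ j ih => simpa [code] using ih

theorem monomialCode_single (i : Fin n) : monomialCode v j k (Finsupp.single i 1) =
    code (fun l => if v l = i then 1 else 0) j 1 := by
  simp only [monomialCode, Finsupp.degree_single, Finsupp.single_apply, eq_comm (a := i)]
  congr 1
  · ext l
    split_ifs <;> rfl

/-- Capping before adding does not change the capped sum, so having equal codes is a congruence on
monomials. -/
theorem monomialCode_add (m m' : Fin n →₀ ℕ) : monomialCode v j k (m + m') =
    reduceCode (k + 1) j (monomialCode v j k m + monomialCode v j k m') := by
  simp only [monomialCode]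
  rw [code_add, reduceCode_code (fun l _ => by omega)]
  simp only [Finsupp.add_apply, map_add]
  congr 1
  · ext l
    omega
  · omega

/-- The cap k + 1 on the degree exceeds k, so degree exactly k remains distinguishable from larger
degrees; a digit 2 means divisibility by the square. -/
theorem monomialCode_eq_iff (m : Fin n →₀ ℕ) :
    monomialCode v j k m = code (fun _ => 2) j k ↔ (∀ l < j, 2 ≤ m (v l)) ∧ m.degree = k := by
  rw [monomialCode, code_inj (fun l _ => by omega) (fun l _ => by omega)]
  refine and_congr (forall₂_congr fun l _ => ?_) ?_ <;> omega

end MonomialCode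

/-! ## Sums of coefficients over the monomials with a given code -/

section CodeSum

variable {F : Type*} [CommSemiring F] {n : ℕ}

/-- The sum of the coefficients of the monomials `m` with `κ m = c`. -/
noncomputable def codeSum (κ : (Fin n →₀ ℕ) → ℕ) (c : ℕ) : MvPolynomial (Fin n) F →ₗ[F] F :=
  (MvPolynomial.basisMonomials (Fin n) F).constr F fun m => if κ m = c then 1 else 0

theorem codeSum_monomial (κ : (Fin n →₀ ℕ) → ℕ) (c : ℕ) (m : Fin n →₀ ℕ) (a : F) :
    codeSum κ c (MvPolynomial.monomial m a) = if κ m = c then a else 0 := by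
  have h := (MvPolynomial.basisMonomials (Fin n) F).constr_basis F
    (fun m => if κ m = c then (1 : F) else 0) m
  rw [MvPolynomial.coe_basisMonomials] at h
  rw [← mul_one a, ← smul_eq_mul, ← MvPolynomial.smul_monomial, map_smul, codeSum, h]
  split_ifs <;> simp

theorem codeSum_eq_sum (κ : (Fin n →₀ ℕ) → ℕ) (c : ℕ) (f : MvPolynomial (Fin n) F) :
    codeSum κ c f = ∑ m ∈ f.support, if κ m = c then f.coeff m else 0 := by
  conv_lhs => rw [f.as_sum]
  simp only [map_sum, codeSum_monomial]

/-- Both sides are bilinear in `f` and `g`, and for two monomials `hκ` leaves a single nonzero term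
on the right. -/
theorem codeSum_mul {κ : (Fin n →₀ ℕ) → ℕ} {R : ℕ → ℕ} {M : ℕ} (hM : ∀ m, κ m < M)
    (hκ : ∀ m m', κ (m + m') = R (κ m + κ m')) (c : ℕ) (f g : MvPolynomial (Fin n) F) :
    codeSum κ c (f * g) = ∑ p ∈ Finset.range M, ∑ q ∈ Finset.range M,
      if R (p + q) = c then codeSum κ p f * codeSum κ q g else 0 := by
  induction f using MvPolynomial.induction_on' with
  | monomial m a =>
    induction g using MvPolynomial.induction_on' with
    | monomial m' a' =>
      simp only [MvPolynomial.monomial_mul, codeSum_monomial, hκ]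
      rw [Finset.sum_eq_single (κ m), Finset.sum_eq_single (κ m')]
      · simp
      · intro q _ hq
        simp [hq.symm]
      · intro h
        exact absurd (Finset.mem_range.2 (hM m')) h
      · intro p _ hp
        simp [hp.symm]
      · intro h
        exact absurd (Finset.mem_range.2 (hM m)) h
    | add g g' h h' =>
      rw [mul_add, map_add, h, h', ← Finset.sum_add_distrib]
      refine Finset.sum_congr rfl fun p _ => ?_
      rw [← Finset.sum_add_distrib]
      refine Finset.sum_congr rfl fun q _ => ?_
      rw [map_add, mul_add]
      split_ifs <;> simp
  | add f f' h h' =>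
    rw [add_mul, map_add, h, h', ← Finset.sum_add_distrib]
    refine Finset.sum_congr rfl fun p _ => ?_
    rw [← Finset.sum_add_distrib]
    refine Finset.sum_congr rfl fun q _ => ?_
    rw [map_add, add_mul]
    split_ifs <;> simp

end CodeSum

/-! ## Increasing tuples as numbers in base `n` -/

/-- The base `n` digits of `w`. -/
def digit (n w l : ℕ) : ℕ := w / n ^ l % n

/-- The `j` lowest base `n` digits of `w`, read from the lowest one, increase. -/
def IncreasingDigits (n j w : ℕ) : Prop := ∀ l, l + 1 < j → digit n w l < digit n w (l + 1)

theorem strictMono_iff_forall_succ {j : ℕ} (f : ℕ → ℕ) :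
    StrictMono (fun l : Fin j => f l) ↔ ∀ l, l + 1 < j → f l < f (l + 1) := by
  constructor
  · intro h l hl
    exact h (a := ⟨l, by omega⟩) (b := ⟨l + 1, hl⟩) (by simp [Fin.lt_def])
  · intro h
    cases j with
    | zero => exact fun a => a.elim0
    | succ j =>
      rw [Fin.strictMono_iff_lt_succ]
      intro i
      exact h i (by omega)

-- A strictly increasing tuple is determined by its image, and every j-subset has exactly one
-- increasing enumeration.
open scoped Classical in
theorem card_strictMono_into {α : Type*} [LinearOrder α] [Fintype α] (j : ℕ) (A : Finset α) :
    (Finset.univ.filter fun f : Fin j → α => StrictMono f ∧ ∀ l, f l ∈ A).card =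
      A.card.choose j := by
  rw [← Finset.card_powersetCard]
  refine Finset.card_bij (fun f _ => Finset.univ.image f) ?_ ?_ ?_
  · intro f hf
    obtain ⟨hf, hA⟩ := (Finset.mem_filter.1 hf).2
    rw [Finset.mem_powersetCard, Finset.card_image_of_injective _ hf.injective]
    refine ⟨fun x hx => ?_, by simp⟩
    obtain ⟨l, _, rfl⟩ := Finset.mem_image.1 hx
    exact hA l
  · intro f hf g hg h
    have hf := (Finset.mem_filter.1 hf).2.1
    have hg := (Finset.mem_filter.1 hg).2.1
    have hc : (Finset.univ.image f).card = j := by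
      rw [Finset.card_image_of_injective _ hf.injective]; simp
    refine (Finset.orderEmbOfFin_unique hc
      (fun x => Finset.mem_image_of_mem f (Finset.mem_univ x)) hf).trans
      (Finset.orderEmbOfFin_unique hc (fun x => ?_) hg).symm
    rw [show Finset.univ.image f = Finset.univ.image g from h]
    exact Finset.mem_image_of_mem g (Finset.mem_univ x)
  · intro s hs
    obtain ⟨hs, hc⟩ := Finset.mem_powersetCard.1 hs
    refine ⟨s.orderEmbOfFin hc, Finset.mem_filter.2 ⟨Finset.mem_univ _,
      (s.orderEmbOfFin hc).strictMono, fun l => hs (s.orderEmbOfFin_mem hc l)⟩, ?_⟩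
    exact Finset.image_orderEmbOfFin_univ s hc

open scoped Classical in
/-- There are `A.card.choose j` numbers with `j` increasing digits, all of which are in `A`. -/
theorem card_increasingDigits {n : ℕ} (hn : 0 < n) (j : ℕ) (A : Finset (Fin n)) :
    ((Finset.range (n ^ j)).filter fun w => IncreasingDigits n j w ∧
      ∀ l < j, (⟨digit n w l, Nat.mod_lt _ hn⟩ : Fin n) ∈ A).card = A.card.choose j := by
  rw [← card_strictMono_into]
  symm
  -- Base-n digits identify the numbers below n^j with the functions `Fin j → Fin n`.
  have hd (w : Fin (n ^ j)) (l : Fin j) :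
      finFunctionFinEquiv.symm w l = ⟨digit n w l, Nat.mod_lt _ hn⟩ := by
    ext
    rw [finFunctionFinEquiv_symm_apply_val]
    rfl
  have hinc (w : Fin (n ^ j)) : StrictMono (finFunctionFinEquiv.symm w) ↔
      IncreasingDigits n j w := by
    rw [IncreasingDigits, ← strictMono_iff_forall_succ]
    simp only [StrictMono, hd, Fin.lt_def]
  refine Finset.card_bij (fun f _ => (finFunctionFinEquiv f : ℕ)) ?_ ?_ ?_
  · intro f hf
    obtain ⟨w, rfl⟩ := finFunctionFinEquiv.symm.surjective f
    obtain ⟨hf, hA⟩ := (Finset.mem_filter.1 hf).2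
    rw [Equiv.apply_symm_apply, Finset.mem_filter, ← hinc, Finset.mem_range]
    exact ⟨w.isLt, hf, fun l hl => by simpa [hd] using hA ⟨l, hl⟩⟩
  · intro f _ g _ h
    exact finFunctionFinEquiv.injective (Fin.ext h)
  · intro w hw
    obtain ⟨hw, hi, hA⟩ := Finset.mem_filter.1 hw
    let w' : Fin (n ^ j) := ⟨w, Finset.mem_range.1 hw⟩
    refine ⟨finFunctionFinEquiv.symm w', Finset.mem_filter.2 ⟨Finset.mem_univ _,
      (hinc w').2 hi, fun l => ?_⟩, by simp [w']⟩
    rw [hd]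
    exact hA l l.isLt

/-! ## The inclusion-exclusion formula -/

open scoped Classical in
/-- The sum over the increasing tuples `v` of length `j` of the sums of the coefficients of the
monomials of degree `k` that are divisible by the square of each variable in `v`. -/
noncomputable def levelSum {F : Type*} [CommSemiring F] {n : ℕ} (hn : 0 < n) (k j : ℕ)
    (f : MvPolynomial (Fin n) F) : F :=
  ∑ w ∈ Finset.range (n ^ j), if IncreasingDigits n j w then
    codeSum (monomialCode (fun l => ⟨digit n w l, Nat.mod_lt _ hn⟩) j k)
      (code (fun _ => 2) j k) f else 0

/-- Exchange of summations: a monomial of degree k is counted once for each j-subset of its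
variables of exponent at least 2. -/
theorem levelSum_monomial {F : Type*} [CommSemiring F] {n : ℕ} (hn : 0 < n) (k j : ℕ)
    (f : MvPolynomial (Fin n) F) : levelSum hn k j f = ∑ m ∈ f.support,
      if m.degree = k then
        ((Finset.univ.filter fun i => 2 ≤ m i).card.choose j : F) * f.coeff m else 0 := by
  classical
  simp only [levelSum, codeSum_eq_sum, monomialCode_eq_iff, Finset.sum_ite, Finset.sum_const_zero,
    add_zero]
  rw [Finset.sum_filter]
  simp only [Finset.sum_filter]
  simp only [← Finset.sum_filter (s := Finset.range _)]
  rw [Finset.sum_comm]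
  refine Finset.sum_congr rfl fun m _ => ?_
  rw [← card_increasingDigits hn]
  simp only [Finset.mem_filter, Finset.mem_univ, true_and]
  by_cases hm : m.degree = k
  · simp only [hm, and_true, if_true]
    rw [← Finset.sum_filter, Finset.sum_const, nsmul_eq_mul, Finset.filter_filter]
  · simp [hm]

theorem card_two_le_mul_two_le_degree {n : ℕ} (m : Fin n →₀ ℕ) :
    (Finset.univ.filter fun i => 2 ≤ m i).card * 2 ≤ m.degree := by
  rw [Finsupp.degree_eq_sum]
  calc _ ≤ ∑ i with 2 ≤ m i, m i :=
        Finset.card_nsmul_le_sum _ _ _ fun i hi => (Finset.mem_filter.1 hi).2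
    _ ≤ _ := Finset.sum_le_sum_of_subset (Finset.filter_subset _ _)

theorem multilinearCoeffSum_eq {F : Type*} [CommRing F] {n : ℕ} (hn : 0 < n) (k : ℕ)
    (f : MvPolynomial (Fin n) F) : multilinearCoeffSum f k =
      ∑ j ∈ Finset.range (k / 2 + 1), (-1) ^ j * levelSum hn k j f := by
  simp only [levelSum_monomial, Finset.mul_sum]
  rw [Finset.sum_comm, multilinearCoeffSum, Finset.sum_filter]
  refine Finset.sum_congr rfl fun m _ => ?_
  by_cases hm : m.degree = k
  · simp only [hm, true_and, if_true, ← mul_assoc, ← Finset.sum_mul]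
    set d := (Finset.univ.filter fun i => 2 ≤ m i).card with hd
    have hdk : d ≤ k / 2 := by
      have := card_two_le_mul_two_le_degree m
      omega
    -- Proved over ℤ and then cast to `F`, so no assumption on the characteristic enters. The range
    -- stops at k/2 instead of d; the additional binomials vanish.
    have key : ∑ j ∈ Finset.range (k / 2 + 1), (-1 : ℤ) ^ j * (d.choose j : ℤ) =
        if d = 0 then 1 else 0 := by
      rw [← Int.alternating_sum_range_choose]
      symm
      refine Finset.sum_subset (Finset.range_subset_range.2 (by omega)) fun j _ hj => ?_
      rw [Nat.choose_eq_zero_of_lt (by simpa using hj)]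
      simp
    have key' := congrArg (Int.cast : ℤ → F) key
    push_cast at key'
    rw [key']
    have h0 : d = 0 ↔ ∀ i, m i ≤ 1 := by
      rw [hd, Finset.card_eq_zero, Finset.filter_eq_empty_iff]
      exact ⟨fun h i => by have := h (Finset.mem_univ i); omega, fun h i _ => by have := h i; omega⟩
    simp only [h0]
    split_ifs <;> simp
  · simp [hm]

end FieldRAM

/-! ## The program -/

namespace FieldRAM

local notation:60 P:61 " ;; " Q:60 => Cmd.seq P Q

/-! The input registers, the scalar variables, and the array `rV` of the current tuple. -/

local notation "inN" => IExp.read 0 (IExp.const 0)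
local notation "inK" => IExp.read 0 (IExp.const 1)
local notation "inS" => IExp.read 0 (IExp.const 2)
local notation "inO" => IExp.read 0 (IExp.const 3)
local notation "rJ" => 4
local notation "rNP" => 5
local notation "rFP" => 6
local notation "rM" => 7
local notation "rW" => 8
local notation "rX" => 9
local notation "rT" => 10
local notation "rU" => 11
local notation "rV" => 12
local notation "rL" => 13
local notation "rR" => 14
local notation "rP" => 15
local notation "rG" => 16
local notation "rA" => 17
local notation "rB" => 18

/-- Replace `rR` by `reduceCode (k + 1) j x`, where `x` is the value of `rX`. -/
def reduceCmd : Cmd :=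
  .assign rR (.const 0) ;;
  .assign rP (.const 1) ;;
  .loop rL (.var rJ) (
    -- With truncated subtraction, y - (y - 2) is min y 2; here y is the last base-5 digit of `rX`.
    .assign rR (.add (.var rR) (.mul (.var rP)
      (.sub (.sub (.var rX) (.mul (.const 5) (.div (.var rX) (.const 5))))
        (.sub (.sub (.var rX) (.mul (.const 5) (.div (.var rX) (.const 5)))) (.const 2))))) ;;
    .assign rX (.div (.var rX) (.const 5)) ;;
    .assign rP (.mul (.var rP) (.const 5))) ;;
  .assign rR (.add (.var rR) (.mul (.var rP)
    (.sub (.var rX) (.sub (.var rX) (.add inK (.const 1))))))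

/-- Cell `e` of the block of the gate `g`. -/
abbrev cell (g e : IExp) : IExp := .add (.mul g (.var rM)) e

abbrev lhs : IExp := .read 2 (.var rG)
abbrev rhs : IExp := .read 3 (.var rG)

/-- Blocks still hold values from earlier tuples, while variable and constant gates write one cell
only and product gates accumulate. -/
def clearCmd : Cmd :=
  .loop rA (.var rM) (.setF 2 (cell (.var rG) (.var rA)) .zero)

/-- The digit 1 - (|v l - i|) is the equality indicator, the absolute value being a sum of two
truncated differences. At the end `rP` is 5^j, and adding it puts 1 in the degree position. -/
def varCmd : Cmd :=
  .assign rR (.const 0) ;;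
  .assign rP (.const 1) ;;
  .loop rL (.var rJ) (
    .assign rR (.add (.var rR) (.mul (.var rP)
      (.sub (.const 1) (.add (.sub (.read rV (.var rL)) lhs) (.sub lhs (.read rV (.var rL))))))) ;;
    .assign rP (.mul (.var rP) (.const 5))) ;;
  .setF 2 (cell (.var rG) (.add (.var rR) (.var rP))) .one

def addCmd : Cmd :=
  .loop rA (.var rM) (.setF 2 (cell (.var rG) (.var rA))
    (.add (.read 2 (cell lhs (.var rA))) (.read 2 (cell rhs (.var rA)))))

def mulCmd : Cmd :=
  .loop rA (.var rM) (.loop rB (.var rM) (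
    .assign rX (.add (.var rA) (.var rB)) ;;
    reduceCmd ;;
    .setF 2 (cell (.var rG) (.var rR)) (.add (.read 2 (cell (.var rG) (.var rR)))
      (.mul (.read 2 (cell lhs (.var rA))) (.read 2 (cell rhs (.var rB)))))))

/-- Compute the block of the gate `rG` from those of the gates before. -/
def gateCmd : Cmd :=
  clearCmd ;;
  .ite (.eq (.read 1 (.var rG)) (.const 0)) varCmd
    (.ite (.eq (.read 1 (.var rG)) (.const 1))
      (.setF 2 (cell (.var rG) (.const 0)) (.read 0 (.var rG)))
      (.ite (.eq (.read 1 (.var rG)) (.const 2)) addCmd mulCmd))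

def evalCmd : Cmd := .loop rG inS gateCmd

/-- Write the base `n` digits of `rW` to `rV`, and set `rT` to `1` if they increase and to `0`
otherwise. -/
def decodeCmd : Cmd :=
  .assign rX (.var rW) ;;
  .assign rT (.const 1) ;;
  .assign rU (.const 0) ;;
  .loop rL (.var rJ) (
    .setI rV (.var rL) (.sub (.var rX) (.mul inN (.div (.var rX) inN))) ;;
    .assign rX (.div (.var rX) inN) ;;
    .assign rT (.mul (.var rT) (.sub (.const 1) (.sub (.var rU) (.read rV (.var rL))))) ;;
    .assign rU (.add (.read rV (.var rL)) (.const 1)))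

/-- Cell 0 of field array 3 is the current sign, and cell 0 of array 1 the accumulator. The circuit
is evaluated only for increasing tuples. -/
def tupleCmd : Cmd :=
  decodeCmd ;;
  .ite (.eq (.var rT) (.const 1))
    (evalCmd ;;
      .setF 1 (.const 0) (.add (.read 1 (.const 0)) (.mul (.read 3 (.const 0))
        (.read 2 (cell inO (.add (.mul inK (.var rFP))
          (.div (.sub (.var rFP) (.const 1)) (.const 2))))))))
    .skip

def levelCmd : Cmd :=
  .assign rM (.mul (.add inK (.const 2)) (.var rFP)) ;;
  .loop rW (.var rNP) tupleCmd ;;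
  .assign rNP (.mul (.var rNP) inN) ;;
  .assign rFP (.mul (.var rFP) (.const 5)) ;;
  .setF 3 (.const 0) (.sub .zero (.read 3 (.const 0)))

def mlcCmd : Cmd :=
  .assign rNP (.const 1) ;;
  .assign rFP (.const 1) ;;
  .setF 3 (.const 0) .one ;;
  .loop rJ (.add (.div inK (.const 2)) (.const 1)) levelCmd

/-! ## Specifications -/

variable {F : Type*} [Field F] {b : ℕ} {σ : State F}

theorem runs_reduce {j k x : ℕ} (hJ : σ.ints rJ 0 = j) (hK : σ.ints 0 1 = k)
    (hX : σ.ints rX 0 = x) (h5 : 5 ^ j < 2 ^ b) :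
    Runs b reduceCmd σ (5 * j + 5) fun σ' => σ'.ints rR 0 = reduceCode (k + 1) j x := by
  have h1 : 1 < 2 ^ b := lt_of_le_of_lt (Nat.one_le_pow _ _ (by norm_num)) h5
  refine Runs.with_bounded fun hb => ?_
  have hx : x < 2 ^ b := hX ▸ hb rX 0
  have hred : reduceCode (k + 1) j x < 2 ^ b := (reduceCode_le _ _ _).trans_lt hx
  refine Runs.setI_seq (T := 5 * j + 4) (fun _ => by simp [IExp.val])
    (Runs.setI_seq (T := 5 * j + 3) (fun _ => by simpa [IExp.val] using h1) ?_)
  refine Runs.seq (T := 5 * j + 2) (T' := 1) ?_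
  rw [mul_comm]
  -- The digits already emitted, plus the shifted reduction of what is left in `rX`, always make up
  -- the final value.
  refine Runs.loop_const (m := j) (T := 3) (fun i σ' => σ'.ints rX 0 = x / 5 ^ i ∧
    σ'.ints rP 0 = 5 ^ i ∧ σ'.ints rR 0 + 5 ^ i * reduceCode (k + 1) (j - i) (x / 5 ^ i) =
      reduceCode (k + 1) j x) ?_ ?_ ?_ ?_ ?_
  · intro σ' hf
    simp [IExp.val, hf.ints rJ (by decide), hJ]
  · exact fun _ => (Nat.lt_pow_self (by norm_num)).trans h5
  · simp [IExp.val, hX]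
  · intro i σ' hi hf hL ⟨hX', hP', hR'⟩
    obtain ⟨d, hd⟩ : ∃ d, j - i = d + 1 := ⟨j - i - 1, by omega⟩
    have hd' : j - (i + 1) = d := by omega
    rw [hd] at hR'
    have hmod : x / 5 ^ i - 5 * (x / 5 ^ i / 5) - (x / 5 ^ i - 5 * (x / 5 ^ i / 5) - 2) =
        min (x / 5 ^ i % 5) 2 := by omega
    have hpow : 5 ^ (i + 1) ≤ 5 ^ j := Nat.pow_le_pow_right (by norm_num) hi
    have hdiv : x / 5 ^ i / 5 = x / 5 ^ (i + 1) := by rw [Nat.div_div_eq_div_mul, pow_succ]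
    simp only [hdiv] at hmod
    simp only [reduceCode, hdiv] at hR'
    have hR'' : σ'.ints rR 0 + 5 ^ i * min (x / 5 ^ i % 5) 2 +
        5 ^ (i + 1) * reduceCode (k + 1) d (x / 5 ^ (i + 1)) = reduceCode (k + 1) j x := by
      rw [← hR', pow_succ]
      ring
    refine Runs.setI_seq ?_ (Runs.setI_seq ?_ (Runs.setI ?_ ?_))
    · intro _
      simp only [IExp.val, hX', hP', hdiv, hmod]
      omega
    · intro hb
      simp only [IExp.val, State.setI_ints, hX']
      simpa [hX'] using (Nat.div_le_self _ _).trans_lt ((Nat.div_le_self _ _).trans_lt hx)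
    · intro _
      simp [IExp.val, hP']
      rw [← pow_succ]
      omega
    · intro _
      simp [IExp.val, hP', hX', hdiv, hd', hmod, ← pow_succ, hR'']
  · intro σ' hf ⟨hX', hP', hR'⟩ hf'
    have hmin : x / 5 ^ j - (x / 5 ^ j - (k + 1)) = min (x / 5 ^ j) (k + 1) := by omega
    have hK' : σ'.ints 0 1 = k := by
      rw [hf.ints 0 (by decide)]
      simpa using hK
    simp only [Nat.sub_self, reduceCode] at hR'
    refine Runs.setI ?_ ?_
    · intro _
      simpa [IExp.val, hX', hP', hK', hmin, hR'] using hred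
    · simp [IExp.val, hX', hP', hK', hmin, hR']

/-- Blocks are ordered like their gates, so writing the block of `g` leaves the operand blocks
intact. -/
theorem block_lt {l g c m : ℕ} (h : l < g) (hc : c < m) : l * m + c < g * m :=
  calc l * m + c < (l + 1) * m := by rw [add_one_mul]; omega
    _ ≤ g * m := Nat.mul_le_mul_right _ h

theorem runs_clear {g m : ℕ} (hG : σ.ints rG 0 = g) (hM : σ.ints rM 0 = m) :
    Runs b clearCmd σ (3 * m + 2) fun σ' => (∀ c < m, σ'.flds 2 (g * m + c) = 0) ∧
      ∀ x < g * m, σ'.flds 2 x = σ.flds 2 x := by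
  rw [mul_comm]
  refine Runs.loop_const (m := m) (T := 1) (fun i σ' => (∀ c < i, σ'.flds 2 (g * m + c) = 0) ∧
      ∀ x < g * m, σ'.flds 2 x = σ.flds 2 x) ?_ (fun hb => hM ▸ hb rM 0) ?_ ?_ ?_
  · intro σ' hf
    simp [IExp.val, hf.ints rM (by decide), hM]
  · simp
  · intro i σ' hi hf hA ⟨h1, h2⟩
    refine Runs.setF fun _ => ?_
    simp only [IExp.val, FExp.val, hA, hf.ints rG (by decide), hf.ints rM (by decide), hG, hM,
      State.setI_flds, State.setF_flds, if_true, Function.update_apply]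
    refine ⟨fun c hc => ?_, fun x hx => ?_⟩
    · split_ifs
      exacts [rfl, h1 c (by omega)]
    · rw [if_neg (by omega), h2 x hx]
  · exact fun _ _ h => h

theorem runs_var {j g m i : ℕ} {v : ℕ → ℕ} (hG : σ.ints rG 0 = g) (hM : σ.ints rM 0 = m)
    (hJ : σ.ints rJ 0 = j) (hV : ∀ l < j, σ.ints rV l = v l) (hi : σ.ints 2 g = i)
    (h0 : ∀ c < m, σ.flds 2 (g * m + c) = 0) (h5 : 5 ^ j < 2 ^ b)
    (hb : code (fun l => if v l = i then 1 else 0) j 1 < 2 ^ b) :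
    Runs b varCmd σ (4 * j + 5) fun σ' => (∀ c < m, σ'.flds 2 (g * m + c) =
        if code (fun l => if v l = i then 1 else 0) j 1 = c then 1 else 0) ∧
      ∀ x < g * m, σ'.flds 2 x = σ.flds 2 x := by
  have h1 : 1 < 2 ^ b := lt_of_le_of_lt (Nat.one_le_pow _ _ (by norm_num)) h5
  set a : ℕ → ℕ := fun l => if v l = i then 1 else 0 with ha
  refine Runs.setI_seq (T := 4 * j + 4) (fun _ => by simp [IExp.val])
    (Runs.setI_seq (T := 4 * j + 3) (fun _ => by simpa [IExp.val] using h1) ?_)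
  refine Runs.seq (T := 4 * j + 2) (T' := 1) ?_
  rw [mul_comm]
  refine Runs.loop_const (m := j) (T := 2) (fun i' σ' => σ'.ints rP 0 = 5 ^ i' ∧
    σ'.ints rR 0 + 5 ^ i' * code (fun l => a (l + i')) (j - i') 1 = code a j 1) ?_ ?_ ?_ ?_ ?_
  · intro σ' hf
    simp [IExp.val, hf.ints rJ (by decide), hJ]
  · exact fun _ => (Nat.lt_pow_self (by norm_num)).trans h5
  · simp [IExp.val]
  · intro i' σ' hi' hf hL ⟨hP', hR'⟩
    obtain ⟨d, hd⟩ : ∃ d, j - i' = d + 1 := ⟨j - i' - 1, by omega⟩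
    have hd' : j - (i' + 1) = d := by omega
    rw [hd] at hR'
    have hpow : 5 ^ (i' + 1) ≤ 5 ^ j := Nat.pow_le_pow_right (by norm_num) hi'
    have hGs : σ'.ints rG 0 = g := by simpa [hG] using congrFun (hf.ints rG (by decide)) 0
    have hIs : σ'.ints 2 g = i := by simpa [hi] using congrFun (hf.ints 2 (by decide)) g
    have hVs : σ'.ints rV i' = v i' := by
      simpa [hV i' hi'] using congrFun (hf.ints rV (by decide)) i'
    have hsub : 1 - ((v i' - i) + (i - v i')) = a i' := by
      simp only [ha]
      split_ifs <;> omega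
    have hR'' : σ'.ints rR 0 + 5 ^ i' * a i' +
        5 ^ (i' + 1) * code (fun l => a (l + (i' + 1))) d 1 = code a j 1 := by
      rw [← hR', code]
      simp only [zero_add, add_right_comm _ 1 i', ← add_assoc]
      ring
    refine Runs.setI_seq ?_ (Runs.setI ?_ ?_)
    · intro _
      simp only [IExp.val, hL, hP', hGs, hIs, hVs, hsub]
      omega
    · intro _
      simp [IExp.val, hP']
      rw [← pow_succ]
      omega
    · intro _
      simp [IExp.val, hL, hP', hGs, hIs, hVs, hsub, hd', ← pow_succ, hR'']
  · intro σ' hf ⟨hP', hR'⟩ hf'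
    have hGs : σ'.ints rG 0 = g := by simpa [hG] using congrFun (hf.ints rG (by decide)) 0
    have hMs : σ'.ints rM 0 = m := by simpa [hM] using congrFun (hf.ints rM (by decide)) 0
    have hF : σ'.flds 2 = σ.flds 2 := by simpa using hf.flds 2 (by decide)
    simp only [Nat.sub_self, code, mul_one] at hR'
    refine Runs.setF ?_
    simp only [IExp.val, FExp.val, hGs, hMs, hP', hR', hF, State.setF_flds, if_true,
      Function.update_apply]
    refine ⟨fun c hc => ?_, fun x hx => ?_⟩
    · rw [h0 c hc]
      simp only [Nat.add_left_cancel_iff, eq_comm]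
    · rw [if_neg (by omega)]

theorem runs_add {g m l r : ℕ} (hG : σ.ints rG 0 = g) (hM : σ.ints rM 0 = m)
    (hl : σ.ints 2 g = l) (hr : σ.ints 3 g = r) (hlg : l < g) (hrg : r < g) :
    Runs b addCmd σ (3 * m + 2) fun σ' => (∀ c < m, σ'.flds 2 (g * m + c) =
        σ.flds 2 (l * m + c) + σ.flds 2 (r * m + c)) ∧
      ∀ x < g * m, σ'.flds 2 x = σ.flds 2 x := by
  rw [mul_comm]
  refine Runs.loop_const (m := m) (T := 1) (fun i σ' => (∀ c < i, σ'.flds 2 (g * m + c) =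
      σ.flds 2 (l * m + c) + σ.flds 2 (r * m + c)) ∧
      ∀ x < g * m, σ'.flds 2 x = σ.flds 2 x) ?_ (fun hb => hM ▸ hb rM 0) ?_ ?_ ?_
  · intro σ' hf
    simp [IExp.val, hf.ints rM (by decide), hM]
  · simp
  · intro i σ' hi hf hA ⟨h1, h2⟩
    refine Runs.setF fun _ => ?_
    simp only [IExp.val, FExp.val, hA, hf.ints rG (by decide), hf.ints rM (by decide),
      hf.ints 2 (by decide), hf.ints 3 (by decide), hG, hM, hl, hr,
      State.setI_flds, State.setF_flds, if_true, Function.update_apply]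
    refine ⟨fun c hc => ?_, fun x hx => ?_⟩
    · split_ifs with h
      · obtain rfl : c = i := by omega
        rw [h2 _ (block_lt hlg hi), h2 _ (block_lt hrg hi)]
      · exact h1 c (by omega)
    · rw [if_neg (by omega), h2 x hx]
  · exact fun _ _ h => h

theorem runs_mul {j k g m l r : ℕ} (hG : σ.ints rG 0 = g) (hM : σ.ints rM 0 = m)
    (hJ : σ.ints rJ 0 = j) (hK : σ.ints 0 1 = k)
    (hl : σ.ints 2 g = l) (hr : σ.ints 3 g = r) (hlg : l < g) (hrg : r < g)
    (h0 : ∀ c < m, σ.flds 2 (g * m + c) = 0) (h5 : 5 ^ j < 2 ^ b) (h2m : 2 * m < 2 ^ b) :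
    Runs b mulCmd σ (m * (m * (5 * j + 9) + 4) + 2) fun σ' =>
      (∀ c < m, σ'.flds 2 (g * m + c) = ∑ p ∈ Finset.range m, ∑ q ∈ Finset.range m,
        if reduceCode (k + 1) j (p + q) = c then
          σ.flds 2 (l * m + p) * σ.flds 2 (r * m + q) else 0) ∧
      ∀ x < g * m, σ'.flds 2 x = σ.flds 2 x := by
  set z : ℕ → ℕ → ℕ → F := fun c p q => if reduceCode (k + 1) j (p + q) = c then
    σ.flds 2 (l * m + p) * σ.flds 2 (r * m + q) else 0 with hz
  refine Runs.loop_const (m := m) (T := m * (5 * j + 9) + 2) (fun i σ' =>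
      (∀ c < m, σ'.flds 2 (g * m + c) = ∑ p ∈ Finset.range i, ∑ q ∈ Finset.range m, z c p q) ∧
      ∀ x < g * m, σ'.flds 2 x = σ.flds 2 x) ?_ (fun hb => hM ▸ hb rM 0) ?_ ?_ ?_
  · intro σ' hf
    simp [IExp.val, hf.ints rM (by decide), hM]
  · simpa using h0
  · intro p σ₁ hp hf₁ hA ⟨h1, h2⟩
    -- The block holds all complete rows before `p` and the first entries of row `p` of the
    -- convolution.
    refine Runs.loop_const (m := m) (T := 5 * j + 7) (fun i σ' =>
      (∀ c < m, σ'.flds 2 (g * m + c) = ∑ p ∈ Finset.range p, ∑ q ∈ Finset.range m, z c p q +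
        ∑ q ∈ Finset.range i, z c p q) ∧
      ∀ x < g * m, σ'.flds 2 x = σ.flds 2 x) ?_ (fun _ => by omega) ?_ ?_ ?_
    · intro σ' hf
      simp [IExp.val, hf.ints rM (by decide), hf₁.ints rM (by decide), hM]
    · simpa using ⟨h1, h2⟩
    · intro q σ₂ hq hf₂ hB ⟨h3, h4⟩
      have hA₂ : σ₂.ints rA 0 = p := by rw [hf₂.ints rA (by decide), hA]
      have hK₂ : σ₂.ints 0 1 = k := by
        rw [hf₂.ints 0 (by decide), hf₁.ints 0 (by decide), hK]
      have hJ₂ : σ₂.ints rJ 0 = j := by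
        rw [hf₂.ints rJ (by decide), hf₁.ints rJ (by decide), hJ]
      have hG₂ : σ₂.ints rG 0 = g := by
        rw [hf₂.ints rG (by decide), hf₁.ints rG (by decide), hG]
      have hM₂ : σ₂.ints rM 0 = m := by
        rw [hf₂.ints rM (by decide), hf₁.ints rM (by decide), hM]
      have hl₂ : σ₂.ints 2 g = l := by
        rw [hf₂.ints 2 (by decide), hf₁.ints 2 (by decide), hl]
      have hr₂ : σ₂.ints 3 g = r := by
        rw [hf₂.ints 3 (by decide), hf₁.ints 3 (by decide), hr]
      refine Runs.setI_seq (T := 5 * j + 6) ?_ (Runs.seq (T := 5 * j + 5) (T' := 1) ?_)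
      · intro _
        simp only [IExp.val, hA₂, hB]
        omega
      refine (runs_reduce (j := j) (k := k) (x := p + q) ?_ ?_ ?_ h5).mono le_rfl ?_
      · simpa using hJ₂
      · simpa using hK₂
      · simp [IExp.val, hA₂, hB]
      intro σ₃ hf₃ hR _
      have hA₃ : σ₃.ints rA 0 = p := by simpa [hA₂] using congrFun (hf₃.ints rA (by decide)) 0
      have hB₃ : σ₃.ints rB 0 = q := by simpa [hB] using congrFun (hf₃.ints rB (by decide)) 0
      have hG₃ : σ₃.ints rG 0 = g := by simpa [hG₂] using congrFun (hf₃.ints rG (by decide)) 0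
      have hM₃ : σ₃.ints rM 0 = m := by simpa [hM₂] using congrFun (hf₃.ints rM (by decide)) 0
      have hl₃ : σ₃.ints 2 g = l := by simpa [hl₂] using congrFun (hf₃.ints 2 (by decide)) g
      have hr₃ : σ₃.ints 3 g = r := by simpa [hr₂] using congrFun (hf₃.ints 3 (by decide)) g
      have hF₃ : σ₃.flds 2 = σ₂.flds 2 := by simpa using hf₃.flds 2 (by decide)
      refine Runs.setF fun _ => ?_
      simp only [IExp.val, FExp.val, hA₃, hB₃, hG₃, hM₃, hl₃, hr₃, hF₃, hR,
        State.setI_flds, State.setF_flds, if_true, Function.update_apply]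
      rw [h4 _ (block_lt hlg hp), h4 _ (block_lt hrg hq)]
      refine ⟨fun c hc => ?_, fun x hx => ?_⟩
      · rw [Finset.sum_range_succ, ← add_assoc]
        simp only [Nat.add_left_cancel_iff]
        split_ifs with h
        · rw [← h, h3 c hc]
          simp [hz, h.symm]
        · rw [h3 c hc]
          simp [hz, Ne.symm h]
      · rw [if_neg (by omega), h4 x hx]
    · intro σ' hf' ⟨h3, h4⟩ _
      simpa [Finset.sum_range_succ] using ⟨h3, h4⟩
  · exact fun _ _ h => h

/-! ### Evaluating the circuit for one tuple -/

variable {n : ℕ} {C : ArithCircuit F n} {v : ℕ → Fin n} {j k : ℕ}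

/-- The memory holds the input and the tuple `v 0, …, v (j - 1)`. -/
structure Ready (C : ArithCircuit F n) (v : ℕ → Fin n) (j k : ℕ) (σ : State F) : Prop where
  ints : ∀ a < 4, σ.ints a = (input C k).ints a
  flds : σ.flds 0 = (input C k).flds 0
  len : σ.ints rJ 0 = j
  size : σ.ints rM 0 = (k + 2) * 5 ^ j
  tuple : ∀ l < j, σ.ints rV l = v l

/-- The blocks of the gates before `G` hold the sums of the coefficients of the polynomials at
these gates. -/
def Filled (C : ArithCircuit F n) (v : ℕ → Fin n) (j k G : ℕ) (σ : State F) : Prop :=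
  ∀ g (hg : g < C.size), g < G → ∀ c < (k + 2) * 5 ^ j,
    σ.flds 2 (g * ((k + 2) * 5 ^ j) + c) = codeSum (monomialCode v j k) c (C.polyAt ⟨g, hg⟩)

theorem Ready.of_frame {σ' : State F} {P : Cmd} (h : Ready C v j k σ) (hf : Frame P σ σ')
    (hI : ∀ a ∈ [0, 1, 2, 3, rJ, rM, rV], a ∉ P.writesI := by decide)
    (hF : 0 ∉ P.writesF := by decide) : Ready C v j k σ' where
  ints a ha := by rw [hf.ints a (hI a (by interval_cases a <;> decide)), h.ints a ha]
  flds := by rw [hf.flds 0 hF, h.flds]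
  len := by rw [hf.ints rJ (hI _ (by decide)), h.len]
  size := by rw [hf.ints rM (hI _ (by decide)), h.size]
  tuple l hl := by rw [hf.ints rV (hI _ (by decide)), h.tuple l hl]

/-- The time for one gate. -/
def gateTime (j k : ℕ) : ℕ :=
  3 * ((k + 2) * 5 ^ j) +
    ((k + 2) * 5 ^ j * ((k + 2) * 5 ^ j * (5 * j + 9) + 4) + 2) + 5

theorem Filled.succ {σ' : State F} {g : ℕ} (hg : g < C.size) (h : Filled C v j k g σ)
    (h1 : ∀ c < (k + 2) * 5 ^ j, σ'.flds 2 (g * ((k + 2) * 5 ^ j) + c) =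
      codeSum (monomialCode v j k) c (C.polyAt ⟨g, hg⟩))
    (h2 : ∀ x < g * ((k + 2) * 5 ^ j), σ'.flds 2 x = σ.flds 2 x) : Filled C v j k (g + 1) σ' := by
  intro g' hg' hlt c hc
  rcases Nat.lt_succ_iff_lt_or_eq.1 hlt with hlt | rfl
  · rw [h2 _ (block_lt hlt hc), h g' hg' hlt c hc]
  · exact h1 c hc

/-- Variables and constants are scalar multiples of one monomial, hence occupy a single cell; sums
use linearity of `codeSum`, and products its convolution formula. -/
theorem runs_gate {g : ℕ} (h : Ready C v j k σ) (hG : σ.ints rG 0 = g) (hg : g < C.size)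
    (hfill : Filled C v j k g σ) (h2m : 2 * ((k + 2) * 5 ^ j) < 2 ^ b) :
    Runs b gateCmd σ (gateTime j k) (Filled C v j k (g + 1)) := by
  have h5m : 5 ^ j ≤ (k + 2) * 5 ^ j := Nat.le_mul_of_pos_left _ (by omega)
  have h5 : 5 ^ j < 2 ^ b := by omega
  set m := (k + 2) * 5 ^ j with hm
  have hm1 : 1 ≤ m := Nat.mul_pos (by omega) (by positivity)
  have hm2 : m * (5 * j + 9) + 4 ≤ m * (m * (5 * j + 9) + 4) := Nat.le_mul_of_pos_left _ hm1
  have hm3 : 5 * j + 9 ≤ m * (5 * j + 9) := Nat.le_mul_of_pos_left _ hm1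
  have hm4 : m * 4 ≤ m * (m * (5 * j + 9) + 4) := Nat.mul_le_mul_left _ (by omega)
  -- The product branch dominates the others; naming its nonlinear cost makes it an atom for
  -- `omega`.
  obtain ⟨big, hbig⟩ : ∃ big, big = m * (m * (5 * j + 9) + 4) + 2 := ⟨_, rfl⟩
  have htime : gateTime j k = 3 * m + 2 + (big + 3) := by
    rw [gateTime, ← hm, hbig]
    ring
  rw [htime]
  refine Runs.seq ((runs_clear hG h.size).mono le_rfl ?_)
  intro σ₁ hf₁ ⟨hz, hlow⟩ _
  have h₁ : Ready C v j k σ₁ := h.of_frame hf₁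
  replace hz : ∀ c < m, σ₁.flds 2 (g * m + c) = 0 := hz
  have hG₁ : σ₁.ints rG 0 = g := by rw [hf₁.ints rG (by decide), hG]
  have hop : σ₁.ints 1 g = opcode (C.gate ⟨g, hg⟩) := by
    simp [h₁.ints 1 (by norm_num), input, hg]
  have hl : σ₁.ints 2 g = operand₁ (C.gate ⟨g, hg⟩) := by
    simp [h₁.ints 2 (by norm_num), input, hg]
  have hr : σ₁.ints 3 g = operand₂ (C.gate ⟨g, hg⟩) := by
    simp [h₁.ints 3 (by norm_num), input, hg]
  have hc : σ₁.flds 0 g = constant (C.gate ⟨g, hg⟩) := by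
    simp [h₁.flds, input, hg]
  have hfill₁ : Filled C v j k g σ₁ := fun g' hg' hlt c hc => by
    rw [hlow _ (block_lt hlt hc), hfill g' hg' hlt c hc]
  cases hgate : C.gate ⟨g, hg⟩ with
  | var i =>
    rw [hgate] at hop hl
    refine Runs.ite (fun _ => ?_) fun ho =>
      absurd hop (by simpa [BExp.holds, IExp.val, hG₁, opcode] using ho)
    have hcode : code (fun l => if (v l : ℕ) = (i : ℕ) then 1 else 0) j 1 < m := by
      refine (code_lt (fun l _ => by split_ifs <;> omega) _).trans_le ?_
      exact Nat.mul_le_mul_right _ (by omega)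
    refine (runs_var (v := fun l => v l) (i := i) hG₁ h₁.size h₁.len h₁.tuple hl hz h5
      (by omega)).mono (by omega) fun σ₂ _ ⟨h2, h3⟩ => hfill₁.succ hg (fun c hc => ?_) h3
    rw [h2 c hc, ArithCircuit.polyAt, hgate]
    simp only [MvPolynomial.X, codeSum_monomial, monomialCode_single, Fin.ext_iff]
  | const a =>
    rw [hgate] at hop hc
    refine Runs.ite (fun ho => ?_) fun _ => Runs.ite (fun _ => ?_) fun ho => absurd hop ?_
    · simp [BExp.holds, IExp.val, hG₁, hop, opcode] at ho
    · refine (Runs.setF ?_).mono_time (show 1 ≤ big + 1 by omega)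
      simp only [IExp.val, FExp.val, hG₁, h₁.size, hc, ← hm, constant]
      refine hfill₁.succ hg (fun c hc' => ?_) fun x hx => ?_
      · simp only [← hm, State.setF_flds, if_true, Function.update_apply, Nat.add_left_cancel_iff,
          hz c hc']
        rw [ArithCircuit.polyAt, hgate]
        simp only [MvPolynomial.C_apply, codeSum_monomial, monomialCode_zero, eq_comm (a := c)]
      · simp only [← hm] at hx
        simp only [State.setF_flds, if_true, Function.update_apply]
        rw [if_neg (by omega)]
    · simpa [BExp.holds, IExp.val, hG₁, opcode] using ho
  | add l r =>
    rw [hgate] at hop hl hr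
    refine Runs.ite (fun ho => ?_) fun _ => Runs.ite (fun ho => ?_) fun _ =>
      Runs.ite (fun ho => ?_) fun ho => absurd hop ?_
    · simp [BExp.holds, IExp.val, hG₁, hop, opcode] at ho
    · simp [BExp.holds, IExp.val, hG₁, hop, opcode] at ho
    · refine (runs_add hG₁ h₁.size hl hr l.isLt r.isLt).mono (by omega) fun σ₂ _ ⟨h2, h3⟩ =>
        hfill₁.succ hg (fun c hc => ?_) h3
      rw [h2 c hc, ArithCircuit.polyAt, hgate]
      simp only [map_add]
      rw [← hfill₁ l _ l.isLt c hc, ← hfill₁ r _ r.isLt c hc]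
      rfl
    · simpa [BExp.holds, IExp.val, hG₁, opcode] using ho
  | mul l r =>
    rw [hgate] at hop hl hr
    refine Runs.ite (fun ho => ?_) fun _ => Runs.ite (fun ho => ?_) fun _ =>
      Runs.ite (fun ho => ?_) fun _ => ?_
    · simp [BExp.holds, IExp.val, hG₁, hop, opcode] at ho
    · simp [BExp.holds, IExp.val, hG₁, hop, opcode] at ho
    · simp [BExp.holds, IExp.val, hG₁, hop, opcode] at ho
    · refine (runs_mul (k := k) hG₁ h₁.size h₁.len (by simp [h₁.ints 0 (by norm_num), input]) hl hr
        l.isLt r.isLt hz h5 h2m).mono hbig.ge fun σ₂ _ ⟨h2, h3⟩ =>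
        hfill₁.succ hg (fun c hc => ?_) h3
      rw [h2 c hc, ArithCircuit.polyAt, hgate]
      simp only
      rw [codeSum_mul (monomialCode_lt v j k) (monomialCode_add v j k)]
      refine Finset.sum_congr rfl fun p hp => Finset.sum_congr rfl fun q hq => ?_
      rw [← hfill₁ l _ l.isLt p (Finset.mem_range.1 hp),
        ← hfill₁ r _ r.isLt q (Finset.mem_range.1 hq)]
      rfl

theorem runs_eval (h : Ready C v j k σ) (h2m : 2 * ((k + 2) * 5 ^ j) < 2 ^ b) :
    Runs b evalCmd σ (C.size * (gateTime j k + 2) + 2) (Filled C v j k C.size) := by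
  have hS {σ : State F} (h : Ready C v j k σ) : σ.ints 0 2 = C.size := by
    simp [h.ints 0 (by norm_num), input]
  have key {σ' : State F} (hf : Frame evalCmd σ σ') : Ready C v j k σ' := h.of_frame hf
  refine Runs.loop_const (fun G σ' => Filled C v j k G σ') ?_ (fun hb => hS h ▸ hb 0 2) ?_ ?_ ?_
  · exact fun σ' hf => hS (key hf)
  · exact fun g hg hlt => absurd hlt (Nat.not_lt_zero _)
  · exact fun G σ' hG hf hG' hfill =>
      (runs_gate (key hf) hG' hG hfill h2m).mono le_rfl fun _ _ h _ => h
  · exact fun _ _ h => h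

/-! ### Enumerating the tuples and forming the alternating sum -/

open scoped Classical in
theorem runs_decode {w : ℕ} (hn : 0 < n) (hN : σ.ints 0 0 = n) (hJ : σ.ints rJ 0 = j)
    (hW : σ.ints rW 0 = w) (hj : j < 2 ^ b) :
    Runs b decodeCmd σ (6 * j + 5) fun σ' =>
      σ'.ints rT 0 = (if IncreasingDigits n j w then 1 else 0) ∧
      ∀ l < j, σ'.ints rV l = digit n w l := by
  refine Runs.with_bounded fun hb => ?_
  have hw : w < 2 ^ b := hW ▸ hb rW 0
  have hnb : n < 2 ^ b := hN ▸ hb 0 0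
  refine Runs.setI_seq (T := 6 * j + 4) (fun _ => by simpa [IExp.val, hW] using hw)
    (Runs.setI_seq (T := 6 * j + 3) (fun _ => by simp only [IExp.val]; omega)
    (Runs.setI_seq (T := 6 * j + 2) (fun _ => by simp [IExp.val]) ?_))
  rw [mul_comm]
  refine Runs.loop_const (m := j) (T := 4) (fun i σ' => σ'.ints rX 0 = w / n ^ i ∧
    σ'.ints rT 0 = (if IncreasingDigits n i w then 1 else 0) ∧
    σ'.ints rU 0 = (if i = 0 then 0 else digit n w (i - 1) + 1) ∧
    ∀ l < i, σ'.ints rV l = digit n w l) ?_ (fun _ => hj) ?_ ?_ ?_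
  · intro σ' hf
    simp [IExp.val, hf.ints rJ (by decide), hJ]
  · simp [IExp.val, hW, IncreasingDigits]
  · intro i σ' hi hf hL ⟨hX, hT, hU, hV⟩
    have hN' : σ'.ints 0 0 = n := by simpa [hN] using congrFun (hf.ints 0 (by decide)) 0
    have hdiv : w / n ^ i / n = w / n ^ (i + 1) := by rw [Nat.div_div_eq_div_mul, pow_succ]
    have hdig : w / n ^ i - n * (w / n ^ (i + 1)) = digit n w i := by
      rw [← hdiv, digit, Nat.mod_eq_sub_mul_div]
    have hlt : digit n w i < n := Nat.mod_lt _ hn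
    -- `rU` stores the previous digit plus one, and 0 initially. So the factor 1 - (u - d) is 1
    -- exactly when the digit d exceeds its predecessor, and the first digit always passes.
    have hinc : (if IncreasingDigits n i w then 1 else 0) *
        (1 - ((if i = 0 then 0 else digit n w (i - 1) + 1) - digit n w i)) =
        if IncreasingDigits n (i + 1) w then 1 else 0 := by
      cases i with
      | zero => simp [IncreasingDigits]
      | succ i =>
        have : IncreasingDigits n (i + 1 + 1) w ↔
            IncreasingDigits n (i + 1) w ∧ digit n w i < digit n w (i + 1) := by
          simp only [IncreasingDigits, add_lt_add_iff_right]
          exact Nat.forall_lt_succ_right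
        simp only [this, ite_and]
        simp only [Nat.add_eq_zero_iff, one_ne_zero, and_false, if_false, Nat.add_sub_cancel]
        split_ifs <;> omega
    refine Runs.setI_seq ?_ (Runs.setI_seq ?_ (Runs.setI_seq ?_ (Runs.setI ?_ ?_)))
    · intro _
      simp only [IExp.val, hX, hN', hdiv, hdig]
      omega
    · intro _
      simp [IExp.val, hX, hN', hL]
      exact (Nat.div_le_self _ _).trans_lt ((Nat.div_le_self _ _).trans_lt hw)
    · intro _
      simp [IExp.val, hX, hN', hL, hdiv, hdig, hT, hU, hinc]
      split_ifs <;> omega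
    · intro _
      simp [IExp.val, hX, hN', hL, hdiv, hdig, hT, hU, hinc]
      omega
    · intro _
      simp [IExp.val, hX, hN', hL, hdiv, hdig, hT, hU, hinc]
      intro l hl
      rw [Function.update_apply]
      split_ifs with h
      · rw [h]
      · exact hV l (by omega)
  · exact fun _ _ ⟨_, hT, _, hV⟩ => ⟨hT, hV⟩

/-- The time to evaluate the circuit for one tuple. -/
def evalTime (s j k : ℕ) : ℕ := s * (gateTime j k + 2) + 3

open scoped Classical in
theorem runs_tuple {w : ℕ} (hn : 0 < n) (hI : ∀ a < 4, σ.ints a = (input C k).ints a)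
    (hF : σ.flds 0 = (input C k).flds 0) (hJ : σ.ints rJ 0 = j) (hFP : σ.ints rFP 0 = 5 ^ j)
    (hM : σ.ints rM 0 = (k + 2) * 5 ^ j) (hW : σ.ints rW 0 = w)
    (h2m : 2 * ((k + 2) * 5 ^ j) < 2 ^ b) :
    Runs b tupleCmd σ (6 * j + 7 + if IncreasingDigits n j w then evalTime C.size j k else 0)
      fun σ' => σ'.flds 1 0 = σ.flds 1 0 + σ.flds 3 0 * if IncreasingDigits n j w then
        codeSum (monomialCode (fun l => ⟨digit n w l, Nat.mod_lt _ hn⟩) j k)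
          (code (fun _ => 2) j k) C.poly else 0 := by
  have hj : j < 2 ^ b := by
    have := Nat.lt_pow_self (n := j) (show 1 < 5 by norm_num)
    have : 5 ^ j ≤ (k + 2) * 5 ^ j := Nat.le_mul_of_pos_left _ (by omega)
    omega
  set E := (if IncreasingDigits n j w then evalTime C.size j k else 0) with hE
  rw [show 6 * j + 7 + E = 6 * j + 5 + (1 + E + 1) by ring]
  refine Runs.seq ((runs_decode hn (by simp [hI 0 (by norm_num), input]) hJ hW hj).mono le_rfl ?_)
  intro σ₁ hf₁ ⟨hT, hV⟩ _
  have hF1 : σ₁.flds 1 = σ.flds 1 := hf₁.flds 1 (by decide)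
  have hF3 : σ₁.flds 3 = σ.flds 3 := hf₁.flds 3 (by decide)
  refine Runs.ite (fun ho => ?_) fun ho => ?_
  · have hinc : IncreasingDigits n j w := by
      by_contra h
      simp [BExp.holds, IExp.val, hT, h] at ho
    set v : ℕ → Fin n := fun l => ⟨digit n w l, Nat.mod_lt _ hn⟩ with hv
    have hready : Ready C v j k σ₁ :=
      ⟨fun a ha => by
        rw [hf₁.ints a (by
          have : ∀ a < 4, a ∉ decodeCmd.writesI := by decide
          exact this a ha), hI a ha],
        by rw [hf₁.flds 0 (by decide), hF], by rw [hf₁.ints rJ (by decide), hJ],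
        by rw [hf₁.ints rM (by decide), hM], hV⟩
    rw [show 1 + E = C.size * (gateTime j k + 2) + 2 + 2 by
      rw [hE, if_pos hinc, evalTime]; ring]
    refine Runs.seq (T' := 2) ((runs_eval hready h2m).mono le_rfl ?_)
    intro σ₂ hf₂ hfill _
    refine (Runs.setF ?_).mono_time one_le_two
    have h₂ : Ready C v j k σ₂ := hready.of_frame hf₂
    have hO : σ₂.ints 0 3 = C.out := by simp [h₂.ints 0 (by norm_num), input]
    have hK : σ₂.ints 0 1 = k := by simp [h₂.ints 0 (by norm_num), input]
    have hFP₂ : σ₂.ints rFP 0 = 5 ^ j := by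
      rw [hf₂.ints rFP (by decide), hf₁.ints rFP (by decide), hFP]
    have hcode : code (fun _ => 2) j k < (k + 2) * 5 ^ j :=
      (code_lt (fun _ _ => by norm_num) _).trans_le (Nat.mul_le_mul_right _ (by omega))
    simp only [IExp.val, FExp.val, hO, hK, h₂.size, hFP₂, State.setF_flds, if_true,
      Function.update_self, if_pos hinc]
    rw [← code_two, hfill C.out C.out.isLt C.out.isLt _ hcode, hf₂.flds 1 (by decide),
      hf₂.flds 3 (by decide), hF1, hF3]
    rfl
  · have hinc : ¬ IncreasingDigits n j w := by
      intro h
      simp [BExp.holds, IExp.val, hT, h] at ho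
    refine (Runs.skip ?_).mono_time (by omega)
    simp [hF1, hinc]

/-- The time for all tuples of length `j`. -/
def levelTime (n s j k : ℕ) : ℕ := n ^ j * (6 * j + 9) + n.choose j * evalTime s j k + 6

/-- Every number below n^j pays for decoding, but only the C(n, j) increasing ones pay for an
evaluation. -/
theorem runs_level (hn : 0 < n) (hI : ∀ a < 4, σ.ints a = (input C k).ints a)
    (hF : σ.flds 0 = (input C k).flds 0) (hJ : σ.ints rJ 0 = j) (hNP : σ.ints rNP 0 = n ^ j)
    (hFP : σ.ints rFP 0 = 5 ^ j) (h2m : 2 * ((k + 2) * 5 ^ j) < 2 ^ b)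
    (h5 : 5 ^ (j + 1) < 2 ^ b) (hnb : n ^ (j + 1) < 2 ^ b) :
    Runs b levelCmd σ (levelTime n C.size j k) fun σ' => σ'.ints rNP 0 = n ^ (j + 1) ∧
      σ'.ints rFP 0 = 5 ^ (j + 1) ∧ σ'.flds 3 0 = - σ.flds 3 0 ∧
      σ'.flds 1 0 = σ.flds 1 0 + σ.flds 3 0 * levelSum hn k j C.poly := by
  classical
  have hK : σ.ints 0 1 = k := by simp [hI 0 (by norm_num), input]
  have hN : σ.ints 0 0 = n := by simp [hI 0 (by norm_num), input]
  have htime : levelTime n C.size j k = ∑ w ∈ Finset.range (n ^ j),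
      (6 * j + 7 + (if IncreasingDigits n j w then evalTime C.size j k else 0) + 2) + 2 + 3 + 1 := by
    have hcard := card_increasingDigits hn j Finset.univ
    simp only [Finset.mem_univ, implies_true, and_true, Finset.card_univ, Fintype.card_fin] at hcard
    simp only [Finset.sum_add_distrib, ← Finset.sum_filter, Finset.sum_const, smul_eq_mul, hcard,
      Finset.card_range, levelTime]
    ring
  rw [htime]
  refine Runs.setI_seq (fun _ => ?_) (Runs.seq (T' := 3) ?_)
  · simp only [IExp.val, hK, hFP]
    omega
  set σ₀ := σ.setI rM ((IExp.const 0).val σ) ((IExp.mul (.add inK (.const 2)) (.var rFP)).val σ) with hσ₀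
  have hM₀ : σ₀.ints rM 0 = (k + 2) * 5 ^ j := by simp [hσ₀, IExp.val, hK, hFP]
  have hne {a : ℕ} (ha : a ≠ rM) : σ₀.ints a = σ.ints a := by simp [hσ₀, ha]
  have hflds : σ₀.flds = σ.flds := rfl
  refine Runs.loop (m := n ^ j) (fun w σ' => σ'.flds 3 = σ.flds 3 ∧ σ'.flds 1 0 = σ.flds 1 0 +
    σ.flds 3 0 * ∑ w ∈ Finset.range w, if IncreasingDigits n j w then
      codeSum (monomialCode (fun l => ⟨digit n w l, Nat.mod_lt _ hn⟩) j k)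
        (code (fun _ => 2) j k) C.poly else 0) ?_ ?_ ?_ ?_ ?_
  · intro σ' hf
    simp [IExp.val, hf.ints rNP (by decide), hne, hNP]
  · exact fun _ => (Nat.pow_le_pow_right hn (Nat.le_succ j)).trans_lt hnb
  · simp [hflds]
  · intro w σ₁ hw hf₁ hW ⟨h3, h1⟩
    refine (runs_tuple (C := C) (k := k) (j := j) (w := w) hn ?_ ?_ ?_ ?_ ?_ hW h2m).mono le_rfl ?_
    · intro a ha
      rw [hf₁.ints a (by
          have : ∀ a < 4, a ∉ (Cmd.loop rW (.var rNP) tupleCmd).writesI := by decide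
          exact this a ha), hne (by omega), hI a ha]
    · rw [hf₁.flds 0 (by decide), hflds, hF]
    · rw [hf₁.ints rJ (by decide), hne (by norm_num), hJ]
    · rw [hf₁.ints rFP (by decide), hne (by norm_num), hFP]
    · rw [hf₁.ints rM (by decide), hM₀]
    · intro σ₂ hf₂ h _
      refine ⟨?_, ?_⟩
      · rw [State.setI_flds, hf₂.flds 3 (by decide), h3]
      · rw [State.setI_flds, h, h1, h3, Finset.sum_range_succ, mul_add, add_assoc]
  · intro σ₁ hf₁ ⟨h3, h1⟩ _
    have hNP₁ : σ₁.ints rNP 0 = n ^ j := by rw [hf₁.ints rNP (by decide), hne (by norm_num), hNP]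
    have hFP₁ : σ₁.ints rFP 0 = 5 ^ j := by rw [hf₁.ints rFP (by decide), hne (by norm_num), hFP]
    have hN₁ : σ₁.ints 0 0 = n := by rw [hf₁.ints 0 (by decide), hne (by norm_num), hN]
    refine Runs.setI_seq (fun _ => ?_) (Runs.setI_seq (fun _ => ?_) (Runs.setF ?_))
    · simpa [IExp.val, hNP₁, hN₁, ← pow_succ] using hnb
    · simpa [IExp.val, hFP₁, ← pow_succ] using h5
    · simp [IExp.val, FExp.val, hNP₁, hN₁, hFP₁, ← pow_succ, h3, h1, levelSum]

theorem runs_mlc (hn : 0 < n) (h2m : 2 * ((k + 2) * 5 ^ (k / 2)) < 2 ^ b)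
    (h5 : 5 ^ (k / 2 + 1) < 2 ^ b) (hnb : n ^ (k / 2 + 1) < 2 ^ b) :
    Runs b mlcCmd (input C k) (∑ j ∈ Finset.range (k / 2 + 1), (levelTime n C.size j k + 2) + 5)
      fun σ => output σ = multilinearCoeffSum C.poly k := by
  have h1 : 1 < 2 ^ b := lt_of_le_of_lt (Nat.one_le_pow _ _ (by norm_num)) h5
  refine Runs.setI_seq (fun _ => by simpa [IExp.val] using h1)
    (Runs.setI_seq (fun _ => by simpa [IExp.val] using h1) (Runs.setF_seq ?_))
  refine Runs.loop (m := k / 2 + 1) (fun j σ => σ.ints rNP 0 = n ^ j ∧ σ.ints rFP 0 = 5 ^ j ∧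
    σ.flds 3 0 = (-1) ^ j ∧
    σ.flds 1 0 = ∑ j ∈ Finset.range j, (-1) ^ j * levelSum hn k j C.poly) ?_ ?_ ?_ ?_ ?_
  · intro σ hf
    simp [IExp.val, hf.ints 0 (by decide), input]
  · exact fun _ => (Nat.lt_pow_self (by norm_num)).trans h5
  · simp [IExp.val, FExp.val, input]
  · intro j σ hj hf hJ ⟨hNP, hFP, h3, h1⟩
    have hj' : j ≤ k / 2 := by omega
    refine (runs_level (C := C) (k := k) (j := j) hn ?_ ?_ hJ hNP hFP ?_ ?_ ?_).mono le_rfl ?_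
    · intro a ha
      rw [hf.ints a (by
          have : ∀ a < 4, a ∉ (Cmd.loop rJ (.add (.div inK (.const 2)) (.const 1)) levelCmd).writesI :=
            by decide
          exact this a ha)]
      simp only [State.setF_ints, State.setI_ints]
      rw [if_neg (by omega), if_neg (by omega)]
    · rw [hf.flds 0 (by decide)]
      simp
    · exact (Nat.mul_le_mul_left _ (Nat.mul_le_mul_left _
        (Nat.pow_le_pow_right (by norm_num) hj'))).trans_lt h2m
    · exact (Nat.pow_le_pow_right (by norm_num) (by omega)).trans_lt h5
    · exact (Nat.pow_le_pow_right hn (by omega)).trans_lt hnb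
    · intro σ' hf' ⟨h₁, h₂, h₃, h₄⟩ _
      simp [h₁, h₂, h₃, h₄, h1, h3, pow_succ, Finset.sum_range_succ]
  · intro σ hf ⟨_, _, _, h⟩
    rw [output, h, multilinearCoeffSum_eq hn]

end FieldRAM

/-! ## The running time -/

namespace FieldRAM

variable {F : Type*} [Field F] {n : ℕ}

/-- A single term a^j/j! of the exponential series is at most e^a. -/
theorem exists_pow_le_mul_factorial (a : ℕ) : ∃ K : ℕ, ∀ j, a ^ j ≤ K * j.factorial := by
  refine ⟨⌈Real.exp a⌉₊, fun j => ?_⟩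
  have h := Real.pow_div_factorial_le_exp a a.cast_nonneg j
  rw [div_le_iff₀ (by positivity)] at h
  have := h.trans (mul_le_mul_of_nonneg_right (Nat.le_ceil (Real.exp a)) (by positivity))
  exact_mod_cast this

/-- The j! in C(n, j)·j! ≤ n^j swallows a^j; this is what removes the exponential evaluation cost
from the final exponent. -/
theorem choose_mul_pow_le {K a : ℕ} (hK : ∀ j, a ^ j ≤ K * j.factorial) (n j : ℕ) :
    n.choose j * a ^ j ≤ K * n ^ j :=
  calc n.choose j * a ^ j ≤ n.choose j * (K * j.factorial) := Nat.mul_le_mul_left _ (hK j)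
    _ = K * n.descFactorial j := by rw [Nat.descFactorial_eq_factorial_mul_choose]; ring
    _ ≤ K * n ^ j := Nat.mul_le_mul_left _ (Nat.descFactorial_le_pow n j)

/-- A bound for `gateTime j k / 25 ^ j`. -/
def gateBound (k : ℕ) : ℕ := 3 * (k + 2) + ((k + 2) * ((k + 2) * (5 * k + 9) + 4) + 2) + 5

/-- The pair loop contributes two factors 5^j, hence 25^j; everything else is polynomial in k. -/
theorem gateTime_le {j k : ℕ} (hj : j ≤ k) : gateTime j k ≤ 25 ^ j * gateBound k := by
  have h5 : 5 ^ j ≤ 25 ^ j := Nat.pow_le_pow_left (by norm_num) j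
  have h1 : 1 ≤ 25 ^ j := Nat.one_le_pow _ _ (by norm_num)
  calc gateTime j k = 3 * (k + 2) * 5 ^ j + ((k + 2) * (k + 2) * (5 * j + 9) * (5 ^ j * 5 ^ j) +
        4 * (k + 2) * 5 ^ j) + 7 * 1 := by rw [gateTime]; ring
    _ ≤ 3 * (k + 2) * 25 ^ j + ((k + 2) * (k + 2) * (5 * k + 9) * 25 ^ j +
        4 * (k + 2) * 25 ^ j) + 7 * 25 ^ j := by
      rw [← mul_pow]
      gcongr
      norm_num
    _ = _ := by rw [gateBound]; ring

/-- A bound for the running time in units, divided by `n ^ (k / 2)`. -/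
def unitBound (K k s : ℕ) : ℕ :=
  (k + 1) * (6 * k + 17 + K * (s * (gateBound k + 2) + 3)) + 5

theorem levelTime_le {K n s j k : ℕ} (hK : ∀ j, 25 ^ j ≤ K * j.factorial) (hn : 0 < n)
    (hj : j ≤ k / 2) : levelTime n s j k ≤
      n ^ (k / 2) * (6 * k + 15 + K * (s * (gateBound k + 2) + 3)) := by
  have hjk : j ≤ k := by omega
  have h1 : 1 ≤ 25 ^ j := Nat.one_le_pow _ _ (by norm_num)
  have hN : n ^ j ≤ n ^ (k / 2) := Nat.pow_le_pow_right hn hj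
  have hN1 : 1 ≤ n ^ (k / 2) := Nat.one_le_pow _ _ hn
  have heval : evalTime s j k ≤ 25 ^ j * (s * (gateBound k + 2) + 3) :=
    calc evalTime s j k ≤ s * (25 ^ j * gateBound k + 2 * 25 ^ j) + 3 * 25 ^ j := by
          rw [evalTime]
          gcongr
          · exact gateTime_le hjk
          · omega
          · omega
      _ = _ := by ring
  calc levelTime n s j k
      ≤ n ^ (k / 2) * (6 * k + 9) + n.choose j * (25 ^ j * (s * (gateBound k + 2) + 3)) +
        6 * n ^ (k / 2) := by
        rw [levelTime]
        gcongr
        omega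
    _ = n ^ (k / 2) * (6 * k + 15) + n.choose j * 25 ^ j * (s * (gateBound k + 2) + 3) := by ring
    _ ≤ n ^ (k / 2) * (6 * k + 15) + K * n ^ (k / 2) * (s * (gateBound k + 2) + 3) := by
        refine Nat.add_le_add_left (Nat.mul_le_mul_right _ ?_) _
        exact (choose_mul_pow_le hK n j).trans (Nat.mul_le_mul_left _ hN)
    _ = _ := by ring

theorem sum_levelTime_le {K n k : ℕ} (s : ℕ) (hK : ∀ j, 25 ^ j ≤ K * j.factorial) (hn : 0 < n) :
    ∑ j ∈ Finset.range (k / 2 + 1), (levelTime n s j k + 2) + 5 ≤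
      n ^ (k / 2) * unitBound K k s := by
  have hN1 : 1 ≤ n ^ (k / 2) := Nat.one_le_pow _ _ hn
  calc _ ≤ ∑ _j ∈ Finset.range (k / 2 + 1),
        (n ^ (k / 2) * (6 * k + 17 + K * (s * (gateBound k + 2) + 3))) + 5 * n ^ (k / 2) := by
        gcongr with j hj
        · have := levelTime_le (s := s) hK hn (j := j) (k := k) (by simpa [Nat.lt_succ_iff] using hj)
          linarith
        · omega
    _ ≤ (k + 1) * (n ^ (k / 2) * (6 * k + 17 + K * (s * (gateBound k + 2) + 3))) +
        5 * n ^ (k / 2) := by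
        rw [Finset.sum_const, Finset.card_range, smul_eq_mul]
        gcongr
        exact Nat.div_le_self k 2
    _ = _ := by rw [unitBound]; ring

/-- A bound for the bit lengths of the natural numbers in the memory. -/
def bitBound (n k s : ℕ) : ℕ := n * (k + 1) + 5 * (k + 2) + s

theorem bounded_input (C : ArithCircuit F n) (k : ℕ) :
    Bounded (bitBound n k C.size) (input C k) := by
  intro a i
  refine lt_of_le_of_lt ?_ (Nat.lt_two_pow_self (n := bitBound n k C.size))
  have hn : n ≤ n * (k + 1) := Nat.le_mul_of_pos_right _ (by omega)
  have hout := C.out.isLt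
  match a with
  | 0 =>
    match i with
    | 0 | 1 | 2 | 3 | i + 4 => simp only [input, bitBound]; omega
  | 1 | 2 | 3 =>
    simp only [input]
    split_ifs with h
    · cases C.gate ⟨i, h⟩ <;> simp only [opcode, operand₁, operand₂, bitBound] <;> omega
    · omega
  | a + 4 => simp [input]

/-- From 5 ≤ 2^3 and k + 2 < 2^(k+2); the summand 5(k + 2) of `bitBound` covers the resulting
exponents. -/
theorem code_size_lt_two_pow_bitBound (n k s : ℕ) :
    2 * ((k + 2) * 5 ^ (k / 2)) < 2 ^ bitBound n k s ∧ 5 ^ (k / 2 + 1) < 2 ^ bitBound n k s := by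
  have h5 (x : ℕ) : 5 ^ x ≤ 2 ^ (3 * x) := by
    rw [pow_mul]
    exact Nat.pow_le_pow_left (by norm_num) x
  constructor
  · calc 2 * ((k + 2) * 5 ^ (k / 2)) < 2 * (2 ^ (k + 2) * 2 ^ (3 * (k / 2))) := by
          gcongr 2 * ?_
          exact Nat.mul_lt_mul_of_lt_of_le Nat.lt_two_pow_self (h5 _) (by positivity)
      _ = 2 ^ (1 + (k + 2) + 3 * (k / 2)) := by ring
      _ ≤ _ := Nat.pow_le_pow_right two_pos (by rw [bitBound]; omega)
  · exact (h5 _).trans_lt (Nat.pow_lt_pow_right one_lt_two (by rw [bitBound]; omega))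

theorem pow_lt_two_pow_bitBound (n k s : ℕ) : n ^ (k / 2 + 1) < 2 ^ bitBound n k s :=
  calc n ^ (k / 2 + 1) < (2 ^ n) ^ (k / 2 + 1) :=
        Nat.pow_lt_pow_left Nat.lt_two_pow_self (by omega)
    _ = 2 ^ (n * (k / 2 + 1)) := by rw [pow_mul]
    _ ≤ _ := by
      refine Nat.pow_le_pow_right two_pos ?_
      have : n * (k / 2 + 1) ≤ n * (k + 1) := Nat.mul_le_mul_left _ (by omega)
      rw [bitBound]
      omega

theorem monotone_eval_nat (p : Polynomial ℕ) : Monotone fun x => p.eval x := by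
  intro x y h
  simp only [Polynomial.eval_eq_sum_range]
  gcongr

theorem exists_polynomial_bound (p : Polynomial ℕ) (K : ℕ) : ∃ q : Polynomial ℕ, ∀ n k s : ℕ,
    s ≤ p.eval n → unitBound K k s * (200 * (bitBound n k s + 1)) ≤ q.eval (n + k) := by
  -- All bounds are monotone, so n and k may both be replaced by n + k, and the size by p(n + k);
  -- `q` is the resulting polynomial in n + k.
  let X : Polynomial ℕ := Polynomial.X
  let g := 3 * (X + 2) + ((X + 2) * ((X + 2) * (5 * X + 9) + 4) + 2) + 5
  refine ⟨((X + 1) * (6 * X + 17 + Polynomial.C K * (p * (g + 2) + 3)) + 5) *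
    (200 * (X * (X + 1) + 5 * (X + 2) + p + 1)), fun n k s hs => ?_⟩
  have hs' : s ≤ p.eval (n + k) := hs.trans (monotone_eval_nat p (Nat.le_add_right n k))
  calc unitBound K k s * (200 * (bitBound n k s + 1)) ≤ unitBound K (n + k) (p.eval (n + k)) *
        (200 * (bitBound (n + k) (n + k) (p.eval (n + k)) + 1)) := by
        unfold unitBound bitBound gateBound
        gcongr <;> omega
    _ = _ := by simp [X, g, unitBound, bitBound, gateBound]

end FieldRAM

/-- There is one program that, over every field, solves the problem for all circuits; on circuits
of size at most `p(n)`, for a polynomial `p`, it runs in time `poly(n, k) * n ^ (k/2 + c log k)`.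
(For `k = 0` the exponent is read as `0`.) -/
theorem theorem1 :
    ∃ P : FieldRAM.Cmd, ∀ p : Polynomial ℕ, ∃ (c : ℝ) (q : Polynomial ℕ),
      ∀ (F : Type*) [Field F] (n k : ℕ) (C : ArithCircuit F n),
        1 ≤ n → C.size ≤ p.eval n →
        ∃ (σ : FieldRAM.State F) (t : ℕ),
          FieldRAM.Exec P (FieldRAM.input C k) σ t ∧
          FieldRAM.output σ = multilinearCoeffSum C.poly k ∧
          (t : ℝ) ≤ (q.eval (n + k) : ℕ) * (n : ℝ) ^ ((k : ℝ) / 2 + c * Real.logb 2 k) := by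
  obtain ⟨K, hK⟩ := FieldRAM.exists_pow_le_mul_factorial 25
  refine ⟨FieldRAM.mlcCmd, fun p => ?_⟩
  obtain ⟨q, hq⟩ := FieldRAM.exists_polynomial_bound p K
  -- The choice c = 0 makes the logarithmic term vanish, whatever the value of `Real.logb` at k = 0.
  refine ⟨0, q, fun F _ n k C hn hC => ?_⟩
  obtain ⟨h2m, h5⟩ := FieldRAM.code_size_lt_two_pow_bitBound n k C.size
  obtain ⟨σ, t, hexec, ht, -, hout⟩ :=
    FieldRAM.runs_mlc hn h2m h5 (FieldRAM.pow_lt_two_pow_bitBound n k C.size)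
      (FieldRAM.bounded_input C k)
  refine ⟨σ, t, hexec, hout, ?_⟩
  have htime : t ≤ q.eval (n + k) * n ^ (k / 2) :=
    calc t ≤ n ^ (k / 2) * FieldRAM.unitBound K k C.size *
          (200 * (FieldRAM.bitBound n k C.size + 1)) :=
          ht.trans (Nat.mul_le_mul_right _ (FieldRAM.sum_levelTime_le C.size hK hn))
      _ = FieldRAM.unitBound K k C.size * (200 * (FieldRAM.bitBound n k C.size + 1)) *
          n ^ (k / 2) := by ring
      _ ≤ _ := Nat.mul_le_mul_right _ (hq n k C.size hC)
  calc (t : ℝ) ≤ (q.eval (n + k) : ℕ) * (n : ℝ) ^ (k / 2) := by exact_mod_cast htime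
    _ ≤ _ := by
      rw [← Real.rpow_natCast]
      gcongr
      · exact_mod_cast hn
      · rw [zero_mul, add_zero]
        -- The program's exponent is the rounded-down half of k, at most the real k/2; since n ≥ 1,
        -- the power is monotone in the exponent.
        exact Nat.cast_div_le
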